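/- Let $S$ be a countable set and let $P$ be the transition matrix of an irreducible Markov chain on $S$ that is transient, i.e. its Green's function $G(x,y)=\sum_{n\ge 0}P^n(x,y)$ is finite. Fix $o\in S$, let $K(x,y)=G(x,y)/G(o,y)$ be the Martin kernel, and let $\mathcal M$ be the Martin compactification, i.e. the smallest compactification of the discrete set $S$ to which all the functions $K(x,\cdot)$, $x\in S$, extend continuously; its Martin boundary is $\partial\mathcal M=\mathcal M\setminus S$. Let $(X_n)_{n\ge 0}$ be the Markov chain started at $o$, with law $\mathbf P_o$. Let $\mu$ be a probability measure on $\{0,1,2,\dots\}$ with mean $1<\bar\mu=\sum_k k\,\mu(k)<\infty$, and let $(B_n)_{n\ge 0}$ be branching random walk started with a single particle at $o$, with law $\mathbb P_o$ and expectation $\mathbb E_o$: in each time step all particles are independently replaced by random numbers of particles at the same place, with law $\mu$, and then all particles independently take one step according to $P$; $B_n(x)$ is the number of particles at $x$ at time $n$. Regard $B_n$ as the measure $\sum_x B_n(x)\delta_x$ on $\mathcal M$. Then $X_n$ converges $\mathbf P_o$-almost surely in $\mathcal M$ to a random point $X_\infty\in\partial\mathcal M$, and there is a random finite Borel measure $\mathbf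 W$ on $\mathcal M$ such that, $\mathbb P_o$-almost surely, $\bar\mu^{-n}B_n$ converges weakly to $\mathbf W$ as $n\to\infty$, and $\mathbf W$ is supported on the harmonic Martin boundary, i.e. gives mass $0$ to the complement of the support of the law of $X_\infty$ under $\mathbf P_o$. If moreover $\mu$ satisfies the $L\log L$ condition $\sum_{k\ge 1}\mu(k)\,k\log k<\infty$ (which by itself implies $\bar\mu<\infty$), then $$\mathbb E_o[\mathbf W(A)]=\mathbf P_o(X_\infty\in A)\qquad\text{for every Borel set }A\subseteq\mathcal M .$$ -/

import Mathlib

open MeasureTheory Filter Topology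
open scoped ENNReal NNReal

noncomputable section

namespace BRW

/-- The `n`-step transition law `P ^ n (x, ·)` of the Markov chain with transition matrix `P`. -/
def stepLaw {S : Type*} (P : S → PMF S) : ℕ → S → PMF S
  | 0, x => PMF.pure x
  | n + 1, x => (stepLaw P n x).bind P

/-- Every state can be reached from every state. -/
def Irreducible {S : Type*} (P : S → PMF S) : Prop :=
  ∀ x y, ∃ n, 0 < stepLaw P n x y

/-- The Green's function `G(x, y) = ∑ₙ Pⁿ(x, y)`. -/
def green {S : Type*} (P : S → PMF S) (x y : S) : ℝ≥0∞ :=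
  ∑' n, stepLaw P n x y

/-- Every state is transient: the expected number of visits to it is finite. -/
def Transient {S : Type*} (P : S → PMF S) : Prop :=
  ∀ x, green P x x < ∞

/-- The Martin kernel `K(x, y) = G(x, y) / G(o, y)` with base point `o`. -/
def martinKernel {S : Type*} (P : S → PMF S) (o x y : S) : ℝ≥0∞ :=
  green P x y / green P o y

open Classical in
/-- The map sending a state `y` to the values at `y` of all functions `K(x, ·)` and of all
indicators of single states. The indicators make its image discrete. -/
def martinMap {S : Type*} (P : S → PMF S) (o y : S) : S → ℝ≥0∞ × Bool :=
  fun x => (martinKernel P o x y, decide (x = y))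

/-- The Martin compactification: the smallest compactification of the discrete set `S` to which
all `K(x, ·)` extend continuously. It is realised as the closure of the image of `S` in a product
of compact spaces. In every Hausdorff compactification of the discrete set `S` the states are
isolated points, so that the indicators extend continuously as well and impose no extra
condition; for an irreducible transient chain each `K(x, ·)` is bounded, so that it makes no
difference that `ℝ≥0∞` contains `∞`. -/
def MartinCompactification {S : Type*} (P : S → PMF S) (o : S) : Type _ :=
  closure (Set.range (martinMap P o))

instance {S : Type*} (P : S → PMF S) (o : S) : TopologicalSpace (MartinCompactification P o) :=
  inferInstanceAs (TopologicalSpace (closure (Set.range (martinMap P o))))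

instance {S : Type*} (P : S → PMF S) (o : S) : MeasurableSpace (MartinCompactification P o) :=
  borel _

instance {S : Type*} (P : S → PMF S) (o : S) : BorelSpace (MartinCompactification P o) :=
  ⟨rfl⟩

/-- The inclusion of the state space into the Martin compactification. -/
def toMartin {S : Type*} (P : S → PMF S) (o y : S) : MartinCompactification P o :=
  ⟨martinMap P o y, subset_closure (Set.mem_range_self y)⟩

/-- The Martin boundary. -/
def martinBoundary {S : Type*} (P : S → PMF S) (o : S) : Set (MartinCompactification P o) :=
  (Set.range (toMartin P o))ᶜ

/-- `X` is a Markov chain on the (countable, discrete) space `E` with transition probabilities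
`κ`, started at `x₀`. -/
structure IsMarkovChain {Ω E : Type*} [MeasurableSpace Ω] (ℙ : Measure Ω) (κ : E → PMF E)
    (x₀ : E) (X : ℕ → Ω → E) : Prop where
  measurable : ∀ n, Measurable[_, ⊤] (X n)
  start : ∀ᵐ ω ∂ℙ, X 0 ω = x₀
  step : ∀ (n : ℕ) (x : ℕ → E),
    ℙ {ω | ∀ i ≤ n + 1, X i ω = x i} = ℙ {ω | ∀ i ≤ n, X i ω = x i} * κ (x n) (x (n + 1))

/-- The law of the sum of two independent configurations, one of law `p` and one of law `q`. -/
def conv {S : Type*} (p q : PMF (S →₀ ℕ)) : PMF (S →₀ ℕ) :=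
  p.bind fun a => q.bind fun b => PMF.pure (a + b)

theorem conv_left_comm {S : Type*} (p q r : PMF (S →₀ ℕ)) :
    conv p (conv q r) = conv q (conv p r) := by
  simp only [conv, PMF.bind_bind, PMF.pure_bind]
  rw [PMF.bind_comm]
  simp only [add_left_comm]

instance {S : Type*} (f : S → PMF (S →₀ ℕ)) :
    LeftCommutative (fun (x : S) (q : PMF (S →₀ ℕ)) => conv (f x) q) :=
  ⟨fun x y q => conv_left_comm (f x) (f y) q⟩

/-- The law of the configuration that arises from `b` when the particles of `b` are replaced
independently of one another, each particle at `x` by a random configuration of law `f x`. -/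
def replaceParticles {S : Type*} (f : S → PMF (S →₀ ℕ)) (b : S →₀ ℕ) : PMF (S →₀ ℕ) :=
  Multiset.foldr (fun (x : S) (q : PMF (S →₀ ℕ)) => conv (f x) q) (PMF.pure 0)
    (Finsupp.toMultiset b)

/-- One time step of branching random walk: every particle is replaced by a random number, of
law `μ`, of particles at the same place; then all particles take a step of the chain `P`. -/
def brwStep {S : Type*} (P : S → PMF S) (μ : PMF ℕ) (b : S →₀ ℕ) : PMF (S →₀ ℕ) :=
  (replaceParticles (fun x => μ.map fun k => Finsupp.single x k) b).bind
    (replaceParticles fun x => (P x).map fun y => Finsupp.single y 1)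

/-- `B` is a branching random walk with offspring law `μ` on the chain `P`, started with a single
particle at `o`. -/
def IsBRW {Ω S : Type*} [MeasurableSpace Ω] (ℙ : Measure Ω) (P : S → PMF S) (μ : PMF ℕ) (o : S)
    (B : ℕ → Ω → (S →₀ ℕ)) : Prop :=
  IsMarkovChain ℙ (brwStep P μ) (Finsupp.single o 1) B

/-- The mean of the offspring law. -/
def offspringMean (μ : PMF ℕ) : ℝ≥0∞ := ∑' k : ℕ, μ k * k

/-- The `L log L` condition. -/
def LLogL (μ : PMF ℕ) : Prop := Summable fun k : ℕ => (μ k).toReal * (k * Real.log k)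

/-- A configuration of particles as a measure on the Martin compactification. -/
def particleMeasure {S : Type*} (P : S → PMF S) (o : S) (b : S →₀ ℕ) :
    FiniteMeasure (MartinCompactification P o) :=
  ∑ x ∈ b.support, (b x : ℝ≥0) • (diracProba (toMartin P o x)).toFiniteMeasure

/-- The harmonic Martin boundary: the support of the law of the limit point `Xlim` of the chain
started at `o`. -/
def harmonicBoundary {Ω S : Type*} [MeasurableSpace Ω] {P : S → PMF S} {o : S} (ℙ : Measure Ω)
    (Xlim : Ω → MartinCompactification P o) : Set (MartinCompactification P o) :=
  (ℙ.map Xlim).support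

end BRW

end

/-! Write `m` for the offspring mean and `B_n(u)` for the sum of `u` over the particles at time `n`.
Expectations add over particles, so one step of the branching walk turns `u` into `m · Pu` in mean.
Hence `m⁻ⁿ B_n(u)` has mean `E_o[u(X_n)]` (many-to-one, `lintegral_normalized_weigh`) and is a
convergent nonnegative supermartingale when `u` is finite and superharmonic.

Two consequences carry the weak convergence. If a bounded `φ ≥ 0` tends to zero along the chain,
then `v(y) = E_y[sup_k φ(X_k)]` is a superharmonic majorant of `φ` with `E_o[v(X_n)] → 0`; by Fatou
the limit of `m⁻ⁿ B_n(v)` is zero, hence so is that of `m⁻ⁿ B_n(φ)` (`ae_tendsto_weigh_zero`). If a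
bounded `f` converges along the chain, then `h(y) = E_y[lim f(X_n)]` is harmonic and `f - h` tends
to zero along the chain by Lévy's theorem, so `m⁻ⁿ B_n(f)` has the same limit as the martingale `m⁻ⁿ
B_n(h)` (`ae_tendsto_weigh_of_le_one`). Continuous functions on the Martin compactification are such
`f`; a countable dense family of them and compactness of sets of measures of bounded mass produce
`W` (`exists_measurable_weak_limit`).

That the chain converges in the compactification is shown without time reversal. By last exit
decomposition, the probability of hitting a finite `D` from `x` is a combination of the `G(x, y)`,
`y ∈ D`, with weights that do not depend on `x`. So an inequality between Green's functions on `D`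
passes to the probabilities of visiting `D` infinitely often (`mul_measure_frequently_le`). If `K(x,
·)` crossed from below `a` to above `b > a` infinitely often on an event `C`, this would give `b
P_o(C) ≤ P_x(C) ≤ a P_o(C)`, so `P_o(C) = 0`.

Fatou and many-to-one give `E[W] ≤` law of `X_∞` (`bind_limit_le`), whence the claim on the support.
Equality then only needs `E[W]` to have total mass at least one. This is the Kesten–Stigum theorem,
obtained from the iterates of the offspring generating function near one
(`one_le_lintegral_of_tendsto_size`). -/

noncomputable section

namespace BRW

/-! ### Markov chains on path space -/

section PathSpace

variable {E : Type*}

/-- The mean of `g` under `p`. -/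
def mean (p : PMF E) (g : E → ℝ≥0∞) : ℝ≥0∞ := ∑' y, p y * g y

/-- The paths that agree with `x` up to time `n`. -/
def cyl (n : ℕ) (x : ℕ → E) : Set (ℕ → E) := {w | ∀ i ≤ n, w i = x i}

/-- The path after time `n`. -/
def shift (n : ℕ) (w : ℕ → E) : ℕ → E := fun k => w (n + k)

/-- Glue `v` to `x` at time `n`; both prescribe the value there, and `hv` makes them agree. -/
theorem exists_cyl_inter_shift (n : ℕ) (x v : ℕ → E) (hv : v 0 = x n) :
    ∃ z : ℕ → E, (∀ k, z (n + k) = v k) ∧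
      ∀ k, cyl n x ∩ shift n ⁻¹' cyl k v = cyl (n + k) z := by
  let z : ℕ → E := fun i => if i ≤ n then x i else v (i - n)
  have hz : ∀ k, z (n + k) = v k := by
    intro k
    rcases Nat.eq_zero_or_pos k with rfl | hk
    · simp [z, hv]
    · have : ¬ n + k ≤ n := by omega
      simp only [z, if_neg this]
      congr 1
      omega
  refine ⟨z, hz, fun k => ?_⟩
  ext w
  constructor
  · rintro ⟨h1, h2⟩ i hi
    by_cases hin : i ≤ n
    · rw [h1 i hin]; simp [z, hin]
    · have := h2 (i - n) (by omega)
      simp only [shift] at this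
      rw [show n + (i - n) = i by omega] at this
      rw [this]; simp [z, hin]
  · intro h1
    refine ⟨fun i hi => ?_, fun i hi => ?_⟩
    · rw [h1 i (by omega)]; simp [z, hi]
    · change w (n + i) = v i
      rw [h1 (n + i) (by omega), hz]

/-- `Q` is the law of the Markov chain with transition probabilities `κ` started at `x₀`. -/
abbrev IsPathLaw [MeasurableSpace E] (Q : Measure (ℕ → E)) (κ : E → PMF E) (x₀ : E) : Prop :=
  IsMarkovChain Q κ x₀ fun n w => w n

variable [MeasurableSpace E]

theorem iSup_piLE : ⨆ n, (Filtration.piLE (X := fun _ : ℕ => E)) n = MeasurableSpace.pi := by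
  refine le_antisymm (iSup_le fun n => Filtration.piLE.le n) ?_
  refine iSup_le fun i => ?_
  refine le_trans ?_ (le_iSup _ i)
  rw [Filtration.piLE_eq_comap_frestrictLe, MeasurableSpace.pi, MeasurableSpace.comap_iSup]
  refine le_trans ?_ (le_iSup _ ⟨i, by simp⟩)
  rw [MeasurableSpace.comap_comp]
  exact le_rfl

theorem measurable_piLE_apply (n : ℕ) :
    Measurable[Filtration.piLE (X := fun _ : ℕ => E) n] fun w : ℕ → E => w n := by
  rw [Filtration.piLE_eq_comap_frestrictLe]
  have h : (fun w : ℕ → E => w n)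
      = (fun v : (Finset.Iic n → E) => v ⟨n, by simp⟩) ∘ Preorder.frestrictLe n := rfl
  rw [h]
  exact (measurable_pi_apply _).comp (comap_measurable _)

theorem measurableSet_piLE_apply_eq [MeasurableSingletonClass E] (n : ℕ) (y : E) :
    MeasurableSet[Filtration.piLE (X := fun _ : ℕ => E) n] {w : ℕ → E | w n = y} := by
  have h : {w : ℕ → E | w n = y} = (fun w : ℕ → E => w n) ⁻¹' {y} := by
    ext w; simp
  rw [h]
  exact measurable_piLE_apply n (measurableSet_singleton y)

theorem measurable_shift (n : ℕ) : Measurable (shift n : (ℕ → E) → ℕ → E) :=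
  measurable_pi_lambda _ fun _ => measurable_pi_apply _

variable {κ : E → PMF E} {x₀ : E} {Q : Measure (ℕ → E)} {R : E → Measure (ℕ → E)}

theorem IsPathLaw.measure_cyl_succ (h : IsPathLaw Q κ x₀) (n : ℕ) (x : ℕ → E) :
    Q (cyl (n + 1) x) = Q (cyl n x) * κ (x n) (x (n + 1)) := h.step n x

theorem IsPathLaw.measure_cyl_of_ne (h : IsPathLaw Q κ x₀) (n : ℕ) (x : ℕ → E)
    (hx : x 0 ≠ x₀) : Q (cyl n x) = 0 := by
  refine measure_mono_null ?_ (ae_iff.1 h.start)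
  intro w hw
  simpa [hw 0 (Nat.zero_le n)] using hx

variable [DiscreteMeasurableSpace E]

theorem measurableSet_cyl (n : ℕ) (x : ℕ → E) : MeasurableSet (cyl n x) := by
  have h : cyl n x = ⋂ i ∈ Set.Iic n, (fun w : ℕ → E => w i) ⁻¹' {x i} := by
    ext w; simp [cyl]
  rw [h]
  exact MeasurableSet.biInter (Set.to_countable _) fun i _ => measurable_pi_apply i
    (MeasurableSet.of_discrete)

theorem IsPathLaw.measure_cyl_zero [IsProbabilityMeasure Q] (h : IsPathLaw Q κ x₀) (x : ℕ → E)
    (hx : x 0 = x₀) : Q (cyl 0 x) = 1 := by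
  rw [← prob_compl_eq_zero_iff (measurableSet_cyl 0 x)]
  refine measure_mono_null ?_ (ae_iff.1 h.start)
  intro w hw
  simpa [cyl, hx] using hw

theorem IsMarkovChain.isPathLaw_map {Ω : Type*} [MeasurableSpace Ω] {ℙ : Measure Ω}
    {κ : E → PMF E} {x₀ : E} {Y : ℕ → Ω → E} (h : IsMarkovChain ℙ κ x₀ Y) :
    Measurable (fun ω n => Y n ω) ∧ IsPathLaw (ℙ.map fun ω n => Y n ω) κ x₀ := by
  have hm : Measurable (fun ω n => Y n ω) :=
    measurable_pi_lambda _ fun n => (h.measurable n).mono le_rfl le_top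
  refine ⟨hm, fun n => ?_, ?_, fun n x => ?_⟩
  · intro s _
    exact measurable_pi_apply n (MeasurableSet.of_discrete)
  · refine (ae_map_iff hm.aemeasurable
      (measurable_pi_apply 0 (MeasurableSet.of_discrete (s := {x₀})))).2 ?_
    exact h.start
  · change ℙ.map _ (cyl (n + 1) x) = ℙ.map _ (cyl n x) * _
    rw [Measure.map_apply hm (measurableSet_cyl (n + 1) x),
      Measure.map_apply hm (measurableSet_cyl n x)]
    exact h.step n x

theorem measurable_comp_apply {β : Type*} [MeasurableSpace β] (g : E → β) (n : ℕ) :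
    Measurable fun w : ℕ → E => g (w n) :=
  (Measurable.of_discrete (f := g)).comp (measurable_pi_apply n)

/-- Markov property for cylinders. -/
theorem IsPathLaw.measure_cyl_inter_shift (h : IsPathLaw Q κ x₀)
    {y : E} {Q' : Measure (ℕ → E)} [IsProbabilityMeasure Q'] (h' : IsPathLaw Q' κ y)
    (n : ℕ) (x : ℕ → E) (hx : x n = y) (m : ℕ) (v : ℕ → E) :
    Q (cyl n x ∩ shift n ⁻¹' cyl m v) = Q (cyl n x) * Q' (cyl m v) := by
  by_cases hv : v 0 = y
  swap
  · rw [h'.measure_cyl_of_ne m v hv, mul_zero]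
    convert measure_empty (μ := Q)
    ext w
    simp only [Set.mem_inter_iff, Set.mem_preimage, Set.mem_empty_iff_false, iff_false, not_and]
    intro h1 h2
    apply hv
    rw [← h2 0 (Nat.zero_le _), ← hx, ← h1 n le_rfl]
    rfl
  · obtain ⟨z, hz, hcyl⟩ := exists_cyl_inter_shift n x v (hv.trans hx.symm)
    rw [hcyl]
    induction m with
    | zero =>
      rw [h'.measure_cyl_zero v hv, mul_one, ← hcyl 0]
      congr 1
      ext w
      simp only [Set.mem_inter_iff, Set.mem_preimage, and_iff_left_iff_imp]
      intro h1 i hi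
      obtain rfl : i = 0 := by omega
      change w (n + 0) = v 0
      rw [hv, ← hx, ← h1 n le_rfl]
      rfl
    | succ m ih =>
      rw [← add_assoc, h.measure_cyl_succ, ih, h'.measure_cyl_succ, mul_assoc, hz,
        add_assoc, hz]

variable [Countable E]

/-- As `E` is countable, an event that depends on the path up to time `n` is a countable disjoint
union of cylinders, so it suffices to compare on these. -/
theorem setLIntegral_le_of_cyl {Q Q' : Measure (ℕ → E)} {n : ℕ} {F F' : (ℕ → E) → ℝ≥0∞}
    (h : ∀ x, ∫⁻ w in cyl n x, F w ∂Q ≤ ∫⁻ w in cyl n x, F' w ∂Q') {A : Set (ℕ → E)}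
    (hA : MeasurableSet[Filtration.piLE (X := fun _ : ℕ => E) n] A) :
    ∫⁻ w in A, F w ∂Q ≤ ∫⁻ w in A, F' w ∂Q' := by
  rw [Filtration.piLE_eq_comap_frestrictLe] at hA
  obtain ⟨T, -, rfl⟩ := hA
  have hr : Measurable (Preorder.frestrictLe (π := fun _ : ℕ => E) n) :=
    Preorder.measurable_frestrictLe n
  have hU : Preorder.frestrictLe (π := fun _ : ℕ => E) n ⁻¹' T
      = ⋃ t : T, Preorder.frestrictLe (π := fun _ : ℕ => E) n ⁻¹' {t.1} := by
    ext w; simp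
  have hm : ∀ t : T, MeasurableSet (Preorder.frestrictLe (π := fun _ : ℕ => E) n ⁻¹' {t.1}) :=
    fun t => hr (measurableSet_singleton _)
  have hd : Pairwise (Function.onFun Disjoint
      fun t : T => Preorder.frestrictLe (π := fun _ : ℕ => E) n ⁻¹' {t.1}) := by
    intro s t hst
    refine Disjoint.preimage _ ?_
    simpa using fun hh => hst (Subtype.ext hh)
  rw [hU, lintegral_iUnion hm hd, lintegral_iUnion hm hd]
  refine ENNReal.tsum_le_tsum fun t => ?_
  rcases Set.eq_empty_or_nonempty
    (Preorder.frestrictLe (π := fun _ : ℕ => E) n ⁻¹' {t.1}) with he | ⟨v, hv⟩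
  · simp [he]
  · have : Preorder.frestrictLe (π := fun _ : ℕ => E) n ⁻¹' {t.1} = cyl n v := by
      ext w
      simp only [Set.mem_preimage, Set.mem_singleton_iff] at hv ⊢
      rw [← hv]
      constructor
      · intro hw i hi
        exact congrFun hw ⟨i, by simpa using hi⟩
      · intro hw
        funext i
        exact hw i (Finset.mem_Iic.1 i.2)
    rw [this]
    exact h v

theorem setLIntegral_eq_of_cyl {Q Q' : Measure (ℕ → E)} {n : ℕ} {F F' : (ℕ → E) → ℝ≥0∞}
    (h : ∀ x, ∫⁻ w in cyl n x, F w ∂Q = ∫⁻ w in cyl n x, F' w ∂Q') {A : Set (ℕ → E)}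
    (hA : MeasurableSet[Filtration.piLE (X := fun _ : ℕ => E) n] A) :
    ∫⁻ w in A, F w ∂Q = ∫⁻ w in A, F' w ∂Q' :=
  le_antisymm (setLIntegral_le_of_cyl (fun x => (h x).le) hA)
    (setLIntegral_le_of_cyl (fun x => (h x).ge) hA)

theorem measure_ext_of_cyl {Q Q' : Measure (ℕ → E)} [IsFiniteMeasure Q]
    (h : ∀ n x, Q (cyl n x) = Q' (cyl n x)) : Q = Q' := by
  have key : ∀ n (A : Set (ℕ → E)),
      MeasurableSet[Filtration.piLE (X := fun _ : ℕ => E) n] A → Q A = Q' A := by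
    intro n A hA
    have := setLIntegral_eq_of_cyl (Q := Q) (Q' := Q') (F := fun _ => 1) (F' := fun _ => 1)
      (n := n) (by simpa using h n) hA
    simpa using this
  refine ext_of_generate_finite
    {A | ∃ n, MeasurableSet[Filtration.piLE (X := fun _ : ℕ => E) n] A} ?_ ?_ ?_ ?_
  · refine le_antisymm ?_ (MeasurableSpace.generateFrom_le ?_)
    · refine iSup_piLE.symm.le.trans ?_
      exact iSup_le fun n A hA => MeasurableSpace.measurableSet_generateFrom ⟨n, hA⟩
    · rintro A ⟨n, hA⟩
      exact Filtration.piLE.le n A hA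
  · rintro A ⟨n, hA⟩ B ⟨m, hB⟩ -
    exact ⟨max n m, (Filtration.piLE.mono (le_max_left n m) A hA).inter
      (Filtration.piLE.mono (le_max_right n m) B hB)⟩
  · rintro A ⟨n, hA⟩
    exact key n A hA
  · exact key 0 _ MeasurableSet.univ

/-- Markov property: given the past, the future has the law of the chain started afresh. -/
theorem IsPathLaw.map_shift_restrict_cyl [IsProbabilityMeasure Q] (h : IsPathLaw Q κ x₀)
    {y : E} {Q' : Measure (ℕ → E)} [IsProbabilityMeasure Q'] (h' : IsPathLaw Q' κ y)
    (n : ℕ) (x : ℕ → E) (hx : x n = y) :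
    (Q.restrict (cyl n x)).map (shift n) = Q (cyl n x) • Q' := by
  have : IsFiniteMeasure ((Q.restrict (cyl n x)).map (shift n)) := by
    have := measurable_shift (E := E) n
    infer_instance
  refine measure_ext_of_cyl fun m v => ?_
  rw [Measure.map_apply (measurable_shift n) (measurableSet_cyl m v),
    Measure.restrict_apply (measurable_shift n (measurableSet_cyl m v)), Set.inter_comm,
    h.measure_cyl_inter_shift h' n x hx m v]
  simp

/-- Path laws are unique. -/
theorem IsPathLaw.unique [IsProbabilityMeasure Q] {Q' : Measure (ℕ → E)}
    [IsProbabilityMeasure Q'] (h : IsPathLaw Q κ x₀) (h' : IsPathLaw Q' κ x₀) : Q = Q' := by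
  have h1 := h.map_shift_restrict_cyl h' 0 (fun _ => x₀) rfl
  have h0 : (shift 0 : (ℕ → E) → ℕ → E) = id := by
    funext w k; simp [shift]
  have h2 : Q.restrict (cyl 0 fun _ => x₀) = Q := by
    rw [Measure.restrict_eq_self_of_ae_mem]
    filter_upwards [h.start] with w hw i hi
    obtain rfl : i = 0 := by omega
    exact hw
  rw [h0, Measure.map_id, h2, h.measure_cyl_zero _ rfl, one_smul] at h1
  exact h1

theorem IsPathLaw.setLIntegral_shift [∀ y, IsProbabilityMeasure (R y)] [IsProbabilityMeasure Q]
    (h : IsPathLaw Q κ x₀) (hR : ∀ y, IsPathLaw (R y) κ y) {F : (ℕ → E) → ℝ≥0∞}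
    (hF : Measurable F) {n : ℕ} {A : Set (ℕ → E)}
    (hA : MeasurableSet[Filtration.piLE (X := fun _ : ℕ => E) n] A) :
    ∫⁻ w in A, F (shift n w) ∂Q = ∫⁻ w in A, (∫⁻ v, F v ∂(R (w n))) ∂Q := by
  refine setLIntegral_eq_of_cyl (fun x => ?_) hA
  rw [← lintegral_map hF (measurable_shift n), h.map_shift_restrict_cyl (hR (x n)) n x rfl,
    lintegral_smul_measure]
  rw [setLIntegral_congr_fun (g := fun _ => ∫⁻ v, F v ∂(R (x n))) (measurableSet_cyl n x)
    (fun w hw => by simp only [hw n le_rfl])]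
  simp [mul_comm]

theorem IsPathLaw.lintegral_shift [∀ y, IsProbabilityMeasure (R y)] [IsProbabilityMeasure Q]
    (h : IsPathLaw Q κ x₀) (hR : ∀ y, IsPathLaw (R y) κ y) {F : (ℕ → E) → ℝ≥0∞}
    (hF : Measurable F) (n : ℕ) :
    ∫⁻ w, F (shift n w) ∂Q = ∫⁻ w, (∫⁻ v, F v ∂(R (w n))) ∂Q := by
  have := h.setLIntegral_shift hR hF (n := n) MeasurableSet.univ
  simpa using this

theorem IsPathLaw.setLIntegral_succ (h : IsPathLaw Q κ x₀) (g : E → ℝ≥0∞) {n : ℕ}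
    {A : Set (ℕ → E)} (hA : MeasurableSet[Filtration.piLE (X := fun _ : ℕ => E) n] A) :
    ∫⁻ w in A, g (w (n + 1)) ∂Q = ∫⁻ w in A, mean (κ (w n)) g ∂Q := by
  refine setLIntegral_eq_of_cyl (fun x => ?_) hA
  rw [setLIntegral_congr_fun (f := fun w => mean (κ (w n)) g) (g := fun _ => mean (κ (x n)) g)
    (measurableSet_cyl n x) (fun w hw => by simp only [hw n le_rfl])]
  have h1 : ∫⁻ w in cyl n x, g (w (n + 1)) ∂Q
      = ∫⁻ y, g y ∂((Q.restrict (cyl n x)).map fun w => w (n + 1)) :=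
    (lintegral_map (Measurable.of_discrete) (measurable_pi_apply _)).symm
  rw [h1, lintegral_countable']
  simp only [lintegral_const, Measure.restrict_apply MeasurableSet.univ, Set.univ_inter, mean]
  rw [← ENNReal.tsum_mul_right]
  refine tsum_congr fun y => ?_
  rw [Measure.map_apply (measurable_pi_apply _) (measurableSet_singleton y),
    Measure.restrict_apply (measurable_pi_apply _ (measurableSet_singleton y))]
  have h2 : (fun w : ℕ → E => w (n + 1)) ⁻¹' {y} ∩ cyl n x
      = cyl (n + 1) (Function.update x (n + 1) y) := by
    ext w
    simp only [Set.mem_inter_iff, Set.mem_preimage, Set.mem_singleton_iff, cyl, Set.mem_ofPred_eq]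
    constructor
    · rintro ⟨h1, h2⟩ i hi
      rcases Nat.lt_or_ge n i with hh | hh
      · obtain rfl : i = n + 1 := by omega
        simpa using h1
      · rw [Function.update_of_ne (by omega), h2 i hh]
    · intro h1
      refine ⟨by simpa using h1 (n + 1) le_rfl, fun i hi => ?_⟩
      rw [h1 i (by omega), Function.update_of_ne (by omega)]
  have h3 : cyl n (Function.update x (n + 1) y) = cyl n x := by
    ext w
    refine forall₂_congr fun i hi => ?_
    rw [Function.update_of_ne (by omega)]
  rw [h2, h.measure_cyl_succ, h3, Function.update_self, Function.update_of_ne (by omega)]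
  ring

theorem IsPathLaw.lintegral_succ (h : IsPathLaw Q κ x₀) (g : E → ℝ≥0∞) (n : ℕ) :
    ∫⁻ w, g (w (n + 1)) ∂Q = ∫⁻ w, mean (κ (w n)) g ∂Q := by
  have := h.setLIntegral_succ g (n := n) MeasurableSet.univ
  simpa using this

end PathSpace

/-! ### Convergence along paths -/

section Convergence

variable {E : Type*} [MeasurableSpace E]
variable {κ : E → PMF E} {x₀ : E} {Q : Measure (ℕ → E)} {R : E → Measure (ℕ → E)}

/-- The expected supremum of `φ` along the path dominates `φ`. -/
theorem le_lintegral_iSup [∀ y, IsProbabilityMeasure (R y)]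
    (hR : ∀ y, IsPathLaw (R y) κ y) (φ : E → ℝ≥0∞) (y : E) :
    φ y ≤ ∫⁻ v, (⨆ k, φ (v k)) ∂(R y) :=
  calc φ y = ∫⁻ _, φ y ∂(R y) := by simp
    _ ≤ _ := lintegral_mono_ae ((hR y).start.mono fun v hv => le_iSup_of_le 0 (by rw [hv]))

variable [DiscreteMeasurableSpace E] [Countable E]

theorem IsPathLaw.lintegral_le_of_mean_le [IsProbabilityMeasure Q] (h : IsPathLaw Q κ x₀)
    {c : ℝ≥0∞} {g : E → ℝ≥0∞} (hg : ∀ y, mean (κ y) g ≤ c * g y) (n : ℕ) :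
    ∫⁻ w, g (w n) ∂Q ≤ c ^ n * g x₀ := by
  induction n with
  | zero =>
    rw [lintegral_congr_ae (g := fun _ => g x₀) (h.start.mono fun w hw => by simp only [hw])]
    simp
  | succ n ih =>
    rw [h.lintegral_succ g n]
    calc ∫⁻ w, mean (κ (w n)) g ∂Q ≤ ∫⁻ w, c * g (w n) ∂Q := lintegral_mono fun w => hg _
      _ = c * ∫⁻ w, g (w n) ∂Q := lintegral_const_mul _ (measurable_comp_apply g n)
      _ ≤ c * (c ^ n * g x₀) := by gcongr
      _ = c ^ (n + 1) * g x₀ := by ring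

/-- A nonnegative supermartingale of the form `c⁻ⁿ g(wₙ)` converges. -/
theorem IsPathLaw.ae_tendsto_of_mean_le [IsProbabilityMeasure Q] (h : IsPathLaw Q κ x₀)
    {c : ℝ≥0} (hc : c ≠ 0) {g : E → ℝ≥0}
    (hg : ∀ y, mean (κ y) (fun z => (g z : ℝ≥0∞)) ≤ c * g y) :
    ∀ᵐ w ∂Q, ∃ L : ℝ≥0, Tendsto (fun n => c⁻¹ ^ n * g (w n)) atTop (𝓝 L) := by
  let f : ℕ → (ℕ → E) → ℝ≥0 := fun n w => c⁻¹ ^ n * g (w n)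
  have hfm : ∀ n, Measurable (f n) := fun n =>
    (measurable_comp_apply g n).const_mul _
  have hlint : ∀ n, ∫⁻ w, f n w ∂Q ≤ g x₀ := by
    intro n
    simp only [f, ENNReal.coe_mul]
    rw [lintegral_const_mul _
      (measurable_comp_apply (fun z => (g z : ℝ≥0∞)) n)]
    refine (mul_le_mul_right (h.lintegral_le_of_mean_le hg n) _).trans ?_
    rw [← mul_assoc, ← ENNReal.coe_pow, ← ENNReal.coe_mul, ← mul_pow, inv_mul_cancel₀ hc]
    simp
  have hint : ∀ n, Integrable (fun w => (f n w : ℝ)) Q := by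
    intro n
    refine ⟨(hfm n).coe_nnreal_real.aestronglyMeasurable, ?_⟩
    rw [HasFiniteIntegral]
    simp only [NNReal.enorm_eq]
    exact (hlint n).trans_lt ENNReal.coe_lt_top
  have hsup : Supermartingale (fun n w => (f n w : ℝ))
      (Filtration.piLE (X := fun _ : ℕ => E)) Q := by
    refine supermartingale_of_setIntegral_succ_le (fun n => ?_) hint ?_
    · refine Measurable.stronglyMeasurable ?_
      exact (((Measurable.of_discrete (f := g)).comp (measurable_piLE_apply n)).const_mul
        _).coe_nnreal_real
    · intro n s hs
      rw [← ENNReal.ofReal_le_ofReal_iff (integral_nonneg fun w => NNReal.coe_nonneg _),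
        ← lintegral_coe_eq_integral _ (hint n).integrableOn,
        ← lintegral_coe_eq_integral _ (hint (n + 1)).integrableOn]
      simp only [f, ENNReal.coe_mul]
      rw [lintegral_const_mul _ (measurable_comp_apply (fun z => (g z : ℝ≥0∞)) _), lintegral_const_mul _ (measurable_comp_apply (fun z => (g z : ℝ≥0∞)) _),
        h.setLIntegral_succ (fun z => (g z : ℝ≥0∞)) hs]
      calc ((c⁻¹ ^ (n + 1) : ℝ≥0) : ℝ≥0∞) * ∫⁻ w in s, mean (κ (w n)) (fun z => (g z : ℝ≥0∞)) ∂Q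
          ≤ ((c⁻¹ ^ (n + 1) : ℝ≥0) : ℝ≥0∞) * ∫⁻ w in s, c * g (w n) ∂Q := by
            gcongr with w; exact hg _
        _ = ((c⁻¹ ^ (n + 1) : ℝ≥0) : ℝ≥0∞) * (c * ∫⁻ w in s, g (w n) ∂Q) := by
            rw [lintegral_const_mul _ (measurable_comp_apply (fun z => (g z : ℝ≥0∞)) _)]
        _ = ((c⁻¹ ^ n : ℝ≥0) : ℝ≥0∞) * ∫⁻ w in s, g (w n) ∂Q := by
            rw [← mul_assoc, ← ENNReal.coe_mul, pow_succ, mul_assoc (c⁻¹ ^ n),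
              inv_mul_cancel₀ hc, mul_one]
  -- Doob's theorem is applied to the negative, an `L¹`-bounded submartingale.
  have hconv := hsup.neg.exists_ae_tendsto_of_bdd (R := g x₀) (by
    intro n
    rw [eLpNorm_one_eq_lintegral_enorm]
    simp only [Pi.neg_apply, enorm_neg, NNReal.enorm_eq]
    exact hlint n)
  filter_upwards [hconv] with w ⟨a, ha⟩
  have h1 : Tendsto (fun n => (f n w : ℝ)) atTop (𝓝 (-a)) := by
    simpa using ha.neg
  have h2 : 0 ≤ -a := ge_of_tendsto' h1 fun n => NNReal.coe_nonneg _
  refine ⟨(-a).toNNReal, ?_⟩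
  rw [← NNReal.tendsto_coe, Real.coe_toNNReal _ h2]
  exact h1

/-- Lévy's theorem for bounded shift-invariant functions of the path. -/
theorem IsPathLaw.ae_tendsto_lintegral [∀ y, IsProbabilityMeasure (R y)] [IsProbabilityMeasure Q]
    (h : IsPathLaw Q κ x₀) (hR : ∀ y, IsPathLaw (R y) κ y) {F : (ℕ → E) → ℝ≥0∞}
    (hF : Measurable F) (hF1 : ∀ w, F w ≤ 1) (hinv : ∀ n w, F (shift n w) = F w) :
    ∀ᵐ w ∂Q, Tendsto (fun n => ∫⁻ v, F v ∂(R (w n))) atTop (𝓝 (F w)) := by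
  let k : E → ℝ≥0∞ := fun y => ∫⁻ v, F v ∂(R y)
  have hk1 : ∀ y, k y ≤ 1 := fun y => by
    calc k y ≤ ∫⁻ _, 1 ∂(R y) := lintegral_mono hF1
      _ = 1 := by simp
  have hkm : ∀ n, Measurable[Filtration.piLE (X := fun _ : ℕ => E) n]
      fun w : ℕ → E => (k (w n)).toReal := fun n =>
    (Measurable.of_discrete (f := fun y => (k y).toReal)).comp (measurable_piLE_apply n)
  have hle := (Filtration.piLE (X := fun _ : ℕ => E)).le
  have hFi : Integrable (fun w => (F w).toReal) Q :=
    Integrable.of_bound hF.ennreal_toReal.aestronglyMeasurable 1 (ae_of_all _ fun w => by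
      rw [Real.norm_of_nonneg ENNReal.toReal_nonneg]
      exact ENNReal.toReal_le_of_le_ofReal zero_le_one (by simpa using hF1 w))
  have hki : ∀ n, Integrable (fun w : ℕ → E => (k (w n)).toReal) Q := fun n =>
    Integrable.of_bound ((hkm n).mono (hle n) le_rfl).aestronglyMeasurable 1
      (ae_of_all _ fun w => by
        rw [Real.norm_of_nonneg ENNReal.toReal_nonneg]
        exact ENNReal.toReal_le_of_le_ofReal zero_le_one (by simpa using hk1 (w n)))
  -- By the Markov property and the invariance of `F`, the conditional expectation of `F` given the
  -- path up to time `n` is `k (w n)`; Lévy's upward theorem then applies.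
  have hce : ∀ n, (fun w : ℕ → E => (k (w n)).toReal)
      =ᵐ[Q] Q[fun w => (F w).toReal | Filtration.piLE (X := fun _ : ℕ => E) n] := by
    intro n
    refine ae_eq_condExp_of_forall_setIntegral_eq (hle n) hFi
      (fun s _ _ => (hki n).integrableOn) (fun s hs _ => ?_)
      (hkm n).stronglyMeasurable.aestronglyMeasurable
    rw [integral_toReal
        (measurable_comp_apply k n).aemeasurable
        (ae_of_all _ fun w => (hk1 _).trans_lt ENNReal.one_lt_top),
      integral_toReal hF.aemeasurable (ae_of_all _ fun w => (hF1 _).trans_lt ENNReal.one_lt_top),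
      ← h.setLIntegral_shift hR hF hs]
    simp only [hinv]
  have hlim := hFi.tendsto_ae_condExp (ℱ := Filtration.piLE (X := fun _ : ℕ => E))
    (by rw [iSup_piLE]; exact hF.ennreal_toReal.stronglyMeasurable)
  filter_upwards [hlim, ae_all_iff.2 hce] with w hw hw2
  have h3 : Tendsto (fun n => (k (w n)).toReal) atTop (𝓝 (F w).toReal) :=
    hw.congr fun n => (hw2 n).symm
  have h4 := ENNReal.tendsto_ofReal h3
  rw [ENNReal.ofReal_toReal ((hF1 w).trans_lt ENNReal.one_lt_top).ne] at h4
  refine h4.congr fun n => ?_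
  rw [ENNReal.ofReal_toReal ((hk1 _).trans_lt ENNReal.one_lt_top).ne]

/-- First-step analysis. It makes `y ↦ E_y[F]` harmonic when `F` is shift-invariant, and
superharmonic when the shift can only decrease `F`. -/
theorem mean_lintegral_eq [∀ y, IsProbabilityMeasure (R y)] (hR : ∀ y, IsPathLaw (R y) κ y)
    {F : (ℕ → E) → ℝ≥0∞} (hF : Measurable F) (y : E) :
    mean (κ y) (fun z => ∫⁻ v, F v ∂(R z)) = ∫⁻ v, F (shift 1 v) ∂(R y) := by
  rw [(hR y).lintegral_shift hR hF 1, (hR y).lintegral_succ (fun z => ∫⁻ v, F v ∂(R z)) 0,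
    lintegral_congr_ae (g := fun _ => mean (κ y) (fun z => ∫⁻ v, F v ∂(R z)))
      ((hR y).start.mono fun v hv => by simp only [hv])]
  simp

/-- The expected supremum of `φ` along the path is superharmonic. -/
theorem mean_lintegral_iSup_le [∀ y, IsProbabilityMeasure (R y)]
    (hR : ∀ y, IsPathLaw (R y) κ y) (φ : E → ℝ≥0∞) (y : E) :
    mean (κ y) (fun z => ∫⁻ v, (⨆ k, φ (v k)) ∂(R z)) ≤ ∫⁻ v, (⨆ k, φ (v k)) ∂(R y) := by
  rw [mean_lintegral_eq hR (Measurable.iSup fun k => measurable_comp_apply φ k)]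
  exact lintegral_mono fun v => iSup_le fun k => le_iSup_of_le (1 + k) le_rfl

/-- If `φ` tends to zero along the path, so does the expected supremum of `φ` in mean. -/
theorem IsPathLaw.tendsto_lintegral_iSup [∀ y, IsProbabilityMeasure (R y)]
    [IsProbabilityMeasure Q] (h : IsPathLaw Q κ x₀) (hR : ∀ y, IsPathLaw (R y) κ y)
    {φ : E → ℝ≥0∞} (hφ : ∀ y, φ y ≤ 1) (h0 : ∀ᵐ w ∂Q, Tendsto (fun n => φ (w n)) atTop (𝓝 0)) :
    Tendsto (fun n => ∫⁻ w, (∫⁻ v, (⨆ k, φ (v k)) ∂(R (w n))) ∂Q) atTop (𝓝 0) := by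
  have hm : Measurable fun v : ℕ → E => ⨆ k, φ (v k) := Measurable.iSup fun k =>
    measurable_comp_apply φ k
  simp_rw [← h.lintegral_shift hR hm]
  rw [← lintegral_zero (μ := Q) (α := ℕ → E)]
  refine tendsto_lintegral_of_dominated_convergence (fun _ => 1)
    (fun n => hm.comp (measurable_shift n))
    (fun _ => ae_of_all _ fun w => iSup_le fun k => hφ _) (by simp) ?_
  filter_upwards [h0] with w hw
  rw [ENNReal.tendsto_nhds_zero] at hw ⊢
  intro ε hε
  obtain ⟨N, hN⟩ := eventually_atTop.1 (hw ε hε)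
  filter_upwards [eventually_ge_atTop N] with n hn
  exact iSup_le fun k => hN (n + k) (by omega)

end Convergence

/-! ### Green's function and the law of the chain at a fixed time -/

section Green

theorem mean_pure {E : Type*} (x : E) (g : E → ℝ≥0∞) : mean (PMF.pure x) g = g x := by
  classical
  rw [mean, tsum_eq_single x]
  · simp
  · intro y hy
    simp [PMF.pure_apply, hy]

theorem mean_bind {E E' : Type*} (p : PMF E) (q : E → PMF E') (g : E' → ℝ≥0∞) :
    mean (p.bind q) g = mean p fun x => mean (q x) g := by
  simp only [mean, PMF.bind_apply, ← ENNReal.tsum_mul_right, ← ENNReal.tsum_mul_left]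
  rw [ENNReal.tsum_comm]
  simp only [mul_assoc]

variable {S : Type*} {P : S → PMF S}

theorem stepLaw_add (m n : ℕ) (x : S) :
    stepLaw P (m + n) x = (stepLaw P m x).bind (stepLaw P n) := by
  induction n with
  | zero => simp [stepLaw]
  | succ n ih =>
    rw [← add_assoc, stepLaw, ih, PMF.bind_bind]
    rfl

theorem stepLaw_mul_green_le (m : ℕ) (x y z : S) :
    stepLaw P m x y * green P y z ≤ green P x z := by
  rw [green, ← ENNReal.tsum_mul_left]
  calc ∑' n, stepLaw P m x y * stepLaw P n y z ≤ ∑' n, stepLaw P (n + m) x z := by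
        refine ENNReal.tsum_le_tsum fun n => ?_
        rw [add_comm, stepLaw_add, PMF.bind_apply]
        exact ENNReal.le_tsum y
    _ ≤ green P x z := by
        rw [green]
        exact ENNReal.tsum_comp_le_tsum_of_injective (add_left_injective m)
          fun n => stepLaw P n x z

/-- For some `n`, `Pⁿ(y, x) > 0`, and `Pⁿ(y, x) G(x, y) ≤ G(y, y) < ∞`. -/
theorem green_lt_top (hirr : Irreducible P) (htrans : Transient P) (x y : S) :
    green P x y < ∞ := by
  obtain ⟨n, hn⟩ := hirr y x
  by_contra hcon
  have h1 := stepLaw_mul_green_le (P := P) n y x y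
  rw [not_lt_top_iff.1 hcon, ENNReal.mul_top hn.ne'] at h1
  exact absurd (htrans y) (not_lt.2 h1)

theorem green_pos (hirr : Irreducible P) (x y : S) : 0 < green P x y := by
  obtain ⟨n, hn⟩ := hirr x y
  exact hn.trans_le (ENNReal.le_tsum n)

variable [MeasurableSpace S] [DiscreteMeasurableSpace S] [Countable S]
variable {x₀ : S} {Q : Measure (ℕ → S)} {R : S → Measure (ℕ → S)}

theorem IsPathLaw.lintegral_apply [IsProbabilityMeasure Q] (h : IsPathLaw Q P x₀) (n : ℕ)
    (g : S → ℝ≥0∞) : ∫⁻ w, g (w n) ∂Q = mean (stepLaw P n x₀) g := by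
  induction n generalizing g with
  | zero =>
    rw [lintegral_congr_ae (g := fun _ => g x₀) (h.start.mono fun w hw => by simp only [hw]),
      stepLaw, mean_pure]
    simp
  | succ n ih => rw [h.lintegral_succ, ih (fun z => mean (P z) g), stepLaw, mean_bind]

theorem IsPathLaw.measure_apply_eq [IsProbabilityMeasure Q] (h : IsPathLaw Q P x₀) (n : ℕ)
    (y : S) : Q {w | w n = y} = stepLaw P n x₀ y := by
  classical
  have h1 := h.lintegral_apply n (Set.indicator {y} 1)
  have h2 : (fun w : ℕ → S => Set.indicator {y} (1 : S → ℝ≥0∞) (w n))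
      = Set.indicator {w | w n = y} 1 := by
    funext w; simp [Set.indicator]
  have h3 : MeasurableSet {w : ℕ → S | w n = y} :=
    Filtration.piLE.le n _ (measurableSet_piLE_apply_eq n y)
  rw [h2, lintegral_indicator_one h3] at h1
  rw [h1, mean, tsum_eq_single y]
  · simp
  · intro z hz; simp [hz]

/-- The chain started at an arbitrary state has a path law, since every state is visited by the
chain started at `x₀`. -/
theorem IsPathLaw.exists_family [IsProbabilityMeasure Q] (h : IsPathLaw Q P x₀)
    (hirr : Irreducible P) :
    ∃ R : S → Measure (ℕ → S), (∀ y, IsProbabilityMeasure (R y)) ∧ ∀ y, IsPathLaw (R y) P y := by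
  have key : ∀ y, ∃ Q' : Measure (ℕ → S), IsProbabilityMeasure Q' ∧ IsPathLaw Q' P y := by
    intro y
    obtain ⟨n, hn⟩ := hirr x₀ y
    -- Since `Pⁿ(x₀, y) > 0`, some initial path segment ending in `y` has positive probability.
    -- Conditioning on it and shifting by `n` gives the chain started at `y`.
    obtain ⟨x, hx, hpos⟩ : ∃ x : ℕ → S, x n = y ∧ Q (cyl n x) ≠ 0 := by
      classical
      by_contra! hcon
      have h1 := setLIntegral_eq_of_cyl (Q := Q) (Q' := Q) (n := n)
        (F := fun w => Set.indicator {y} (1 : S → ℝ≥0∞) (w n)) (F' := fun _ => 0)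
        (fun x => ?_) MeasurableSet.univ
      · simp only [Measure.restrict_univ, lintegral_zero] at h1
        rw [h.lintegral_apply n] at h1
        simp only [mean, ENNReal.tsum_eq_zero] at h1
        have := h1 y
        simp only [Set.mem_singleton_iff, Set.indicator_of_mem, Pi.one_apply, mul_one] at this
        exact hn.ne' this
      · by_cases hxy : x n = y
        · simp [Measure.restrict_eq_zero.2 (hcon x hxy)]
        · refine setLIntegral_congr_fun (measurableSet_cyl n x) fun w hw => ?_
          simp [hw n le_rfl, hxy]
    have hfin : Q (cyl n x) ≠ ∞ := measure_ne_top _ _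
    let Q' : Measure (ℕ → S) := (Q (cyl n x))⁻¹ • (Q.restrict (cyl n x)).map (shift n)
    have hQ' : ∀ m v, Q' (cyl m v)
        = (Q (cyl n x))⁻¹ * Q (cyl n x ∩ shift n ⁻¹' cyl m v) := by
      intro m v
      simp only [Q', Measure.smul_apply, smul_eq_mul]
      rw [Measure.map_apply (measurable_shift n) (measurableSet_cyl m v),
        Measure.restrict_apply (measurable_shift n (measurableSet_cyl m v)), Set.inter_comm]
    have hstart : ∀ᵐ w ∂Q', w 0 = y := by
      refine Measure.ae_smul_measure ?_ _
      refine (ae_map_iff (measurable_shift n).aemeasurable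
        (measurable_pi_apply 0 (MeasurableSet.of_discrete (s := {y})))).2 ?_
      refine (ae_restrict_iff' (measurableSet_cyl n x)).2 (ae_of_all _ fun w hw => ?_)
      change w (n + 0) = y
      rw [← hx]
      exact hw n le_rfl
    refine ⟨Q', ⟨?_⟩, fun k s _ => measurable_pi_apply k (MeasurableSet.of_discrete), hstart,
      fun m v => ?_⟩
    · simp only [Q', Measure.smul_apply, smul_eq_mul]
      rw [Measure.map_apply (measurable_shift n) MeasurableSet.univ]
      simp [ENNReal.inv_mul_cancel hpos hfin]
    · change Q' (cyl (m + 1) v) = Q' (cyl m v) * _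
      by_cases hv : v 0 = y
      · obtain ⟨z, hz, hcyl⟩ := exists_cyl_inter_shift n x v (hv.trans hx.symm)
        rw [hQ', hQ', hcyl, hcyl, ← add_assoc, h.measure_cyl_succ, hz, add_assoc, hz, mul_assoc]
      · have h0 : ∀ k, Q' (cyl k v) = 0 := by
          intro k
          refine measure_mono_null ?_ (ae_iff.1 hstart)
          intro w hw
          simpa [hw 0 (Nat.zero_le k)] using hv
        rw [h0, h0, zero_mul]
  choose R h1 h2 using key
  exact ⟨R, h1, h2⟩

/-- Borel–Cantelli: the probabilities of being at `y` at time `n` sum to the finite `G(x₀, y)`. -/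
theorem IsPathLaw.ae_eventually_ne [IsProbabilityMeasure Q] (h : IsPathLaw Q P x₀)
    (hirr : Irreducible P) (htrans : Transient P) :
    ∀ᵐ w ∂Q, ∀ y, ∀ᶠ n in atTop, w n ≠ y := by
  rw [ae_all_iff]
  intro y
  have h1 : ∑' n, Q {w | w n = y} ≠ ∞ := by
    simp_rw [h.measure_apply_eq]
    exact (green_lt_top hirr htrans x₀ y).ne
  exact ae_eventually_notMem h1

end Green

/-! ### Convergence to the Martin boundary -/

theorem frequently_shift {S : Type*} (p : S → Prop) (n : ℕ) (w : ℕ → S) :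
    (∃ᶠ k in atTop, p (shift n w k)) ↔ ∃ᶠ k in atTop, p (w k) := by
  conv_rhs => rw [← map_add_atTop_eq_nat n, frequently_map]
  simp only [shift, add_comm]

section Martin

variable {S : Type*} {P : S → PMF S} [MeasurableSpace S] [DiscreteMeasurableSpace S]
variable {x₀ : S} {Q : Measure (ℕ → S)} {R : S → Measure (ℕ → S)}

theorem measurableSet_hit (D : Set S) : MeasurableSet {w : ℕ → S | ∃ n, w n ∈ D} := by
  have h : {w : ℕ → S | ∃ n, w n ∈ D} = ⋃ n, (fun w : ℕ → S => w n) ⁻¹' D := by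
    ext w; simp
  rw [h]
  exact MeasurableSet.iUnion fun n => measurable_pi_apply n MeasurableSet.of_discrete

theorem measurableSet_frequently (D : Set S) :
    MeasurableSet {w : ℕ → S | ∃ᶠ n in atTop, w n ∈ D} := by
  have h : {w : ℕ → S | ∃ᶠ n in atTop, w n ∈ D}
      = ⋂ N : ℕ, ⋃ n : ℕ, ⋃ _ : N ≤ n, (fun w : ℕ → S => w n) ⁻¹' D := by
    ext w; simp [frequently_atTop]
  rw [h]
  exact MeasurableSet.iInter fun N => MeasurableSet.iUnion fun n => MeasurableSet.iUnion fun _ =>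
    measurable_pi_apply n MeasurableSet.of_discrete

variable [Countable S]

/-- Last exit decomposition. -/
theorem IsPathLaw.measure_hit_eq_tsum [∀ y, IsProbabilityMeasure (R y)] [IsProbabilityMeasure Q]
    (h : IsPathLaw Q P x₀) (hR : ∀ y, IsPathLaw (R y) P y) (hirr : Irreducible P)
    (htrans : Transient P) {D : Set S} (hD : D.Finite) :
    Q {w | ∃ n, w n ∈ D}
      = ∑' y : D, green P x₀ y * R y {v | ∀ k, v (k + 1) ∉ D} := by
  have hN : MeasurableSet {v : ℕ → S | ∀ k, v (k + 1) ∉ D} := by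
    have h1 : {v : ℕ → S | ∀ k, v (k + 1) ∉ D}
        = ⋂ k : ℕ, (fun v : ℕ → S => v (k + 1)) ⁻¹' Dᶜ := by
      ext v; simp
    rw [h1]
    exact MeasurableSet.iInter fun k => measurable_pi_apply _ MeasurableSet.of_discrete
  -- `A (n, y)` is the event that the last visit to `D` happens at time `n`, in `y`. Transience
  -- makes the visits to the finite set `D` finite in number, so up to a null set these events
  -- partition the event of hitting `D`.
  let A : ℕ × D → Set (ℕ → S) := fun p =>
    {w | w p.1 = p.2} ∩ shift p.1 ⁻¹' {v | ∀ k, v (k + 1) ∉ D}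
  have hAm : ∀ p, MeasurableSet (A p) := fun p => by
    have h1 : MeasurableSet {w : ℕ → S | w p.1 = p.2} :=
      Filtration.piLE.le p.1 _ (measurableSet_piLE_apply_eq p.1 _)
    exact h1.inter (measurable_shift p.1 hN)
  have hAd : Pairwise (Function.onFun Disjoint A) := by
    rintro ⟨n, y⟩ ⟨m, z⟩ hne
    refine Set.disjoint_left.2 ?_
    rintro w ⟨h1, h2⟩ ⟨h3, h4⟩
    have h1' : w n = y := h1
    have h3' : w m = z := h3
    rcases lt_trichotomy n m with hlt | rfl | hlt
    · have := h2 (m - n - 1)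
      simp only [shift, show n + (m - n - 1 + 1) = m by omega, h3'] at this
      exact this z.2
    · exact hne (Prod.ext rfl (Subtype.ext (h1'.symm.trans h3')))
    · have := h4 (n - m - 1)
      simp only [shift, show m + (n - m - 1 + 1) = n by omega, h1'] at this
      exact this y.2
  have hAmeas : ∀ p, Q (A p) = stepLaw P p.1 x₀ p.2 * R p.2 {v | ∀ k, v (k + 1) ∉ D} := by
    rintro ⟨n, ⟨y, hy⟩⟩
    have h1 := h.setLIntegral_shift hR (F := Set.indicator {v | ∀ k, v (k + 1) ∉ D} 1)
      (measurable_one.indicator hN) (n := n) (A := {w | w n = y})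
      (measurableSet_piLE_apply_eq n y)
    have h2 : (fun w : ℕ → S => Set.indicator {v | ∀ k, v (k + 1) ∉ D} (1 : (ℕ → S) → ℝ≥0∞)
        (shift n w)) = Set.indicator (shift n ⁻¹' {v | ∀ k, v (k + 1) ∉ D}) 1 := by
      funext w; rfl
    rw [h2, lintegral_indicator_one (measurable_shift n hN),
      Measure.restrict_apply (measurable_shift n hN), Set.inter_comm] at h1
    simp only [lintegral_indicator_one hN] at h1
    rw [setLIntegral_congr_fun (g := fun _ => R y {v | ∀ k, v (k + 1) ∉ D})
      (Filtration.piLE.le n _ (measurableSet_piLE_apply_eq n y))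
      (fun w (hw : w n = y) => by simp only [hw])] at h1
    change Q ({w : ℕ → S | w n = y} ∩ shift n ⁻¹' {v | ∀ k, v (k + 1) ∉ D}) = _
    rw [h1, ← h.measure_apply_eq n y]
    simp [mul_comm]
  have hU : Q {w | ∃ n, w n ∈ D} = Q (⋃ p, A p) := by
    refine measure_congr ?_
    filter_upwards [h.ae_eventually_ne hirr htrans] with w hw
    refine propext ⟨fun hhit => ?_, fun hA => ?_⟩
    · obtain ⟨n₀, hn₀⟩ : ∃ n, w n ∈ D := hhit
      have hfin : {n | w n ∈ D}.Finite := by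
        have h1 : ∀ᶠ n in atTop, ∀ y ∈ D, w n ≠ y := (eventually_all_finite hD).2 fun y _ => hw y
        obtain ⟨N, hN⟩ := eventually_atTop.1 h1
        refine (Set.finite_lt_nat N).subset fun n hn => ?_
        by_contra hcon
        exact hN n (not_lt.1 hcon) (w n) hn rfl
      obtain ⟨n, hn, hmax⟩ := hfin.exists_maximal ⟨n₀, hn₀⟩
      refine Set.mem_iUnion.2 ⟨(n, ⟨w n, hn⟩), rfl, fun k hk => ?_⟩
      have := hmax (y := n + (k + 1)) hk (by omega)
      simp at this
    · obtain ⟨⟨n, y⟩, h1, -⟩ := Set.mem_iUnion.1 hA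
      exact ⟨n, by rw [show w n = y from h1]; exact y.2⟩
  rw [hU, measure_iUnion hAd hAm]
  simp only [hAmeas]
  rw [ENNReal.tsum_prod', ENNReal.tsum_comm]
  simp only [green, ENNReal.tsum_mul_right]

variable [∀ y, IsProbabilityMeasure (R y)]

/-- For hitting a finite subset of `D` the inequality is termwise in the last exit decomposition,
whose escape probabilities do not depend on the starting point. Exhausting by the finite sets `T m`
extends it to hitting `D \ T l`; as `l → ∞` these events decrease, up to null sets, to infinitely
many visits to `D`, because every `T l` is eventually left for good. -/
theorem mul_measure_frequently_le (hR : ∀ y, IsPathLaw (R y) P y) (hirr : Irreducible P)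
    (htrans : Transient P) {x x' : S} {c c' : ℝ≥0∞} (hc : c ≠ ∞) (hc' : c' ≠ ∞) {D : Set S}
    (hD : ∀ y ∈ D, c * green P x y ≤ c' * green P x' y) :
    c * R x {w | ∃ᶠ n in atTop, w n ∈ D} ≤ c' * R x' {w | ∃ᶠ n in atTop, w n ∈ D} := by
  obtain ⟨enc, henc⟩ := exists_injective_nat S
  let T : ℕ → Set S := fun l => {y | enc y < l}
  have hT : ∀ l, (T l).Finite := fun l =>
    (Set.finite_lt_nat l).preimage henc.injOn
  have hTmono : ∀ {l m y}, l ≤ m → y ∈ T l → y ∈ T m := fun hlm hy => lt_of_lt_of_le hy hlm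
  have hfin : ∀ l m, c * R x {w | ∃ n, w n ∈ (D \ T l) ∩ T m}
      ≤ c' * R x' {w | ∃ n, w n ∈ (D \ T l) ∩ T m} := by
    intro l m
    rw [(hR x).measure_hit_eq_tsum hR hirr htrans ((hT m).inter_of_right _),
      (hR x').measure_hit_eq_tsum hR hirr htrans ((hT m).inter_of_right _),
      ← ENNReal.tsum_mul_left, ← ENNReal.tsum_mul_left]
    refine ENNReal.tsum_le_tsum fun y => ?_
    rw [← mul_assoc, ← mul_assoc]
    exact mul_le_mul_left (hD y y.2.1.1) _
  have hlim1 : ∀ z l, Tendsto (fun m => R z {w | ∃ n, w n ∈ (D \ T l) ∩ T m}) atTop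
      (𝓝 (R z {w | ∃ n, w n ∈ D \ T l})) := by
    intro z l
    have hU : {w : ℕ → S | ∃ n, w n ∈ D \ T l} = ⋃ m, {w | ∃ n, w n ∈ (D \ T l) ∩ T m} := by
      ext w
      simp only [Set.mem_ofPred_eq, Set.mem_iUnion]
      constructor
      · rintro ⟨n, hn⟩
        exact ⟨enc (w n) + 1, n, hn, Nat.lt_succ_self _⟩
      · rintro ⟨m, n, hn⟩
        exact ⟨n, hn.1⟩
    rw [hU]
    refine tendsto_measure_iUnion_atTop fun m m' hmm w => ?_
    rintro ⟨n, hn⟩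
    exact ⟨n, hn.1, hTmono hmm hn.2⟩
  have hmid : ∀ l, c * R x {w | ∃ n, w n ∈ D \ T l} ≤ c' * R x' {w | ∃ n, w n ∈ D \ T l} :=
    fun l => le_of_tendsto_of_tendsto'
      (ENNReal.Tendsto.const_mul (hlim1 x l) (Or.inr hc))
      (ENNReal.Tendsto.const_mul (hlim1 x' l) (Or.inr hc')) (hfin l)
  have hlim2 : ∀ z, Tendsto (fun l => R z {w | ∃ n, w n ∈ D \ T l}) atTop
      (𝓝 (R z {w | ∃ᶠ n in atTop, w n ∈ D})) := by
    intro z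
    have hI : R z {w | ∃ᶠ n in atTop, w n ∈ D} = R z (⋂ l, {w | ∃ n, w n ∈ D \ T l}) := by
      refine measure_congr ?_
      filter_upwards [(hR z).ae_eventually_ne hirr htrans] with w hw
      refine propext ⟨fun hf => ?_, fun hf => ?_⟩
      · refine Set.mem_iInter.2 fun l => ?_
        have h1 : ∀ᶠ n in atTop, ∀ y ∈ T l, w n ≠ y :=
          (eventually_all_finite (hT l)).2 fun y _ => hw y
        have hf' : ∃ᶠ n in atTop, w n ∈ D := hf
        obtain ⟨n, hn1, hn2⟩ := (hf'.and_eventually h1).exists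
        exact ⟨n, hn1, fun hmem => hn2 _ hmem rfl⟩
      · change ∃ᶠ n in atTop, w n ∈ D
        rw [frequently_atTop]
        intro N
        by_contra! hcon
        let l := (Finset.range N).sup (fun i => enc (w i)) + 1
        obtain ⟨n, hn1, hn2⟩ := Set.mem_iInter.1 hf l
        have hnN : n < N := by
          by_contra hh
          exact hcon n (not_lt.1 hh) hn1
        refine hn2 (Nat.lt_succ_of_le ?_)
        exact Finset.le_sup (f := fun i => enc (w i)) (Finset.mem_range.2 hnN)
    rw [hI]
    refine tendsto_measure_iInter_atTop (fun l => (measurableSet_hit _).nullMeasurableSet)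
      (fun l l' hll w => ?_) ⟨0, measure_ne_top _ _⟩
    rintro ⟨n, hn⟩
    exact ⟨n, hn.1, fun hmem => hn.2 (hTmono hll hmem)⟩
  exact le_of_tendsto_of_tendsto'
    (ENNReal.Tendsto.const_mul (hlim2 x) (Or.inr hc))
    (ENNReal.Tendsto.const_mul (hlim2 x') (Or.inr hc')) hmid

/-- The Martin kernel does not oscillate along the path. -/
theorem measure_oscillation_eq_zero (hR : ∀ y, IsPathLaw (R y) P y) (hirr : Irreducible P)
    (htrans : Transient P) (o x : S) {a b : ℝ≥0∞} (hab : a < b) :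
    R o {w | (∃ᶠ n in atTop, martinKernel P o x (w n) < a) ∧
      ∃ᶠ n in atTop, b < martinKernel P o x (w n)} = 0 := by
  rcases eq_or_ne b ∞ with rfl | hb
  · simp
  let C : Set (ℕ → S) := {w | (∃ᶠ n in atTop, martinKernel P o x (w n) < a) ∧
      ∃ᶠ n in atTop, b < martinKernel P o x (w n)}
  have hC : MeasurableSet C :=
    (measurableSet_frequently {y | martinKernel P o x y < a}).inter
      (measurableSet_frequently {y | b < martinKernel P o x y})
  have hinv : ∀ n w, Set.indicator C (1 : (ℕ → S) → ℝ≥0∞) (shift n w) = Set.indicator C 1 w := by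
    intro n w
    have : shift n w ∈ C ↔ w ∈ C :=
      and_congr (frequently_shift (fun y => martinKernel P o x y < a) n w)
        (frequently_shift (fun y => b < martinKernel P o x y) n w)
    by_cases hw : w ∈ C
    · simp [hw, this.2 hw]
    · simp [hw, mt this.1 hw]
  have hlevy : ∀ z, ∀ᵐ w ∂(R z), Tendsto (fun n => R (w n) C) atTop
      (𝓝 (Set.indicator C 1 w)) := by
    intro z
    have := (hR z).ae_tendsto_lintegral hR (F := Set.indicator C 1)
      (measurable_one.indicator hC) (fun w => Set.indicator_le_self' (by simp) w) hinv
    simpa only [lintegral_indicator_one hC] using this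
  -- By Lévy, `R (w n) C` tends to `1` on `C` and to `0` off `C`. Any threshold strictly between,
  -- here `2⁻¹`, thus turns `C` up to a null set into an event of infinitely many visits, to which
  -- the Green's function comparison applies.
  have hfreq : ∀ (p : S → Prop), (∀ w ∈ C, ∃ᶠ n in atTop, p (w n)) → ∀ z,
      R z {w | ∃ᶠ n in atTop, w n ∈ {y | p y ∧ 2⁻¹ < R y C}} = R z C := by
    intro p hp z
    refine measure_congr ?_
    filter_upwards [hlevy z] with w hw
    refine propext ⟨fun hf => ?_, fun hf => ?_⟩
    · by_contra hcon
      rw [Set.indicator_of_notMem (show w ∉ C from hcon)] at hw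
      have h1 : ∀ᶠ n in atTop, R (w n) C < 2⁻¹ := hw.eventually (gt_mem_nhds (by simp))
      have hf' : ∃ᶠ n in atTop, w n ∈ {y | p y ∧ 2⁻¹ < R y C} := hf
      obtain ⟨n, hn1, hn2⟩ := (hf'.and_eventually h1).exists
      exact absurd hn1.2 hn2.not_gt
    · have hf' : w ∈ C := hf
      rw [Set.indicator_of_mem hf', Pi.one_apply] at hw
      have h1 : ∀ᶠ n in atTop, 2⁻¹ < R (w n) C :=
        hw.eventually (lt_mem_nhds ENNReal.one_half_lt_one)
      exact (hp w hf').and_eventually h1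
  have hG0 : ∀ y, green P o y ≠ 0 := fun y => (green_pos hirr o y).ne'
  have hG1 : ∀ y, green P o y ≠ ∞ := fun y => (green_lt_top hirr htrans o y).ne
  have h1 : 1 * R x C ≤ a * R o C := by
    rw [← hfreq (fun y => martinKernel P o x y < a) (fun w hw => hw.1) x,
      ← hfreq (fun y => martinKernel P o x y < a) (fun w hw => hw.1) o]
    refine mul_measure_frequently_le hR hirr htrans ENNReal.one_ne_top hab.ne_top fun y hy => ?_
    rw [one_mul]
    exact (ENNReal.div_le_iff (hG0 y) (hG1 y)).1 hy.1.le
  have h2 : b * R o C ≤ 1 * R x C := by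
    rw [← hfreq (fun y => b < martinKernel P o x y) (fun w hw => hw.2) x,
      ← hfreq (fun y => b < martinKernel P o x y) (fun w hw => hw.2) o]
    refine mul_measure_frequently_le hR hirr htrans hb ENNReal.one_ne_top fun y hy => ?_
    rw [one_mul]
    exact (ENNReal.le_div_iff_mul_le (Or.inl (hG0 y)) (Or.inl (hG1 y))).1 hy.1.le
  by_contra hcon
  exact absurd (h2.trans h1)
    (not_le.2 (ENNReal.mul_lt_mul_left hcon (measure_ne_top _ _) hab))

/-- Excluding oscillation across the countably many pairs from a dense set already forces
convergence in `ℝ≥0∞`. -/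
theorem ae_tendsto_martinKernel (hR : ∀ y, IsPathLaw (R y) P y) (hirr : Irreducible P)
    (htrans : Transient P) (o : S) :
    ∀ᵐ w ∂(R o), ∀ x, ∃ c, Tendsto (fun n => martinKernel P o x (w n)) atTop (𝓝 c) := by
  rw [ae_all_iff]
  intro x
  obtain ⟨s, hs, hsd⟩ := TopologicalSpace.exists_countable_dense ℝ≥0∞
  have h1 : ∀ᵐ w ∂(R o), ∀ a ∈ s, ∀ b ∈ s, a < b →
      ¬((∃ᶠ n in atTop, martinKernel P o x (w n) < a) ∧
        ∃ᶠ n in atTop, b < martinKernel P o x (w n)) := by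
    rw [ae_ball_iff hs]
    intro a _
    rw [ae_ball_iff hs]
    intro b _
    rw [eventually_imp_distrib_left]
    intro hab
    rw [ae_iff]
    simpa only [not_not] using measure_oscillation_eq_zero hR hirr htrans o x hab
  filter_upwards [h1] with w hw
  exact tendsto_of_no_upcrossings hsd hw

theorem ae_exists_tendsto_toMartin (hR : ∀ y, IsPathLaw (R y) P y) (hirr : Irreducible P)
    (htrans : Transient P) (o : S) :
    ∀ᵐ w ∂(R o), ∃ z ∈ martinBoundary P o, Tendsto (fun n => toMartin P o (w n)) atTop (𝓝 z) := by
  filter_upwards [ae_tendsto_martinKernel hR hirr htrans o, (hR o).ae_eventually_ne hirr htrans]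
    with w hw1 hw2
  choose k hk using hw1
  -- Every state is eventually left, so all indicator coordinates tend to `false`. The image of a
  -- state `y` has `true` at `y`, hence the limit lies on the boundary.
  have hlim : Tendsto (fun n => martinMap P o (w n)) atTop (𝓝 fun x => (k x, false)) := by
    rw [tendsto_pi_nhds]
    intro x
    refine (hk x).prodMk_nhds (tendsto_const_nhds.congr' ?_)
    filter_upwards [hw2 x] with n hn
    simpa using hn.symm
  have hmem : (fun x => (k x, false)) ∈ closure (Set.range (martinMap P o)) :=
    mem_closure_of_tendsto hlim (Eventually.of_forall fun n => Set.mem_range_self _)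
  refine ⟨⟨_, hmem⟩, ?_, ?_⟩
  · rintro ⟨y, hy⟩
    have h1 : martinMap P o y = fun x => (k x, false) := congrArg Subtype.val hy
    have h2 := congrArg Prod.snd (congrFun h1 y)
    simp [martinMap] at h2
  · exact tendsto_subtype_rng.2 hlim

end Martin

/-! ### Moments of branching random walk -/

theorem limsup_shift {S : Type*} (f : S → ℝ≥0∞) (n : ℕ) (w : ℕ → S) :
    limsup (fun k => f (shift n w k)) atTop = limsup (fun k => f (w k)) atTop := by
  rw [← limsup_nat_add (fun k => f (w k)) n]
  simp only [shift, add_comm]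

section Moments

theorem mean_add {E : Type*} (p : PMF E) (g g' : E → ℝ≥0∞) :
    mean p (fun x => g x + g' x) = mean p g + mean p g' := by
  simp only [mean, mul_add, ENNReal.tsum_add]

theorem mean_const {E : Type*} (p : PMF E) (c : ℝ≥0∞) : mean p (fun _ => c) = c := by
  simp only [mean, ENNReal.tsum_mul_right, PMF.tsum_coe, one_mul]

theorem mean_const_mul {E : Type*} (p : PMF E) (c : ℝ≥0∞) (g : E → ℝ≥0∞) :
    mean p (fun x => c * g x) = c * mean p g := by
  simp only [mean, ← ENNReal.tsum_mul_left, mul_left_comm]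

theorem mean_mul_const {E : Type*} (p : PMF E) (c : ℝ≥0∞) (g : E → ℝ≥0∞) :
    mean p (fun x => g x * c) = mean p g * c := by
  simp only [mean, ← ENNReal.tsum_mul_right, mul_assoc]

theorem mean_map {E E' : Type*} (p : PMF E) (φ : E → E') (g : E' → ℝ≥0∞) :
    mean (p.map φ) g = mean p fun x => g (φ x) := by
  rw [PMF.map, mean_bind]
  simp only [Function.comp_apply, mean_pure]

variable {S : Type*} {P : S → PMF S} {μ : PMF ℕ}

/-- The sum of `u` over the particles of a configuration. -/
def weigh (u : S → ℝ≥0∞) (b : S →₀ ℕ) : ℝ≥0∞ := ((Finsupp.toMultiset b).map u).sum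

/-- The number of particles of a configuration. -/
def size (b : S →₀ ℕ) : ℕ := Multiset.card (Finsupp.toMultiset b)

theorem weigh_add (u : S → ℝ≥0∞) (a b : S →₀ ℕ) : weigh u (a + b) = weigh u a + weigh u b := by
  simp [weigh]

theorem weigh_single (u : S → ℝ≥0∞) (x : S) (k : ℕ) :
    weigh u (Finsupp.single x k) = k * u x := by
  simp [weigh, Finsupp.toMultiset_single, Multiset.map_nsmul, Multiset.sum_nsmul]

theorem weigh_eq_sum (u : S → ℝ≥0∞) (b : S →₀ ℕ) : weigh u b = b.sum fun x k => k * u x := by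
  induction b using Finsupp.induction_linear with
  | zero => simp [weigh]
  | add a b ha hb =>
    rw [weigh_add, ha, hb, Finsupp.sum_add_index']
    · simp
    · intro x k l; push_cast; ring
  | single x k => rw [weigh_single, Finsupp.sum_single_index (by simp)]

theorem weigh_mono {u v : S → ℝ≥0∞} (h : ∀ x, u x ≤ v x) (b : S →₀ ℕ) :
    weigh u b ≤ weigh v b := by
  rw [weigh_eq_sum, weigh_eq_sum]
  exact Finset.sum_le_sum fun x _ => mul_le_mul_right (h x) _

theorem weigh_fun_add (u v : S → ℝ≥0∞) (b : S →₀ ℕ) :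
    weigh (fun x => u x + v x) b = weigh u b + weigh v b := by
  simp [weigh, Multiset.sum_map_add]

theorem weigh_const_mul (c : ℝ≥0∞) (u : S → ℝ≥0∞) (b : S →₀ ℕ) :
    weigh (fun x => c * u x) b = c * weigh u b := by
  simp [weigh, Multiset.sum_map_mul_left]

theorem weigh_one (b : S →₀ ℕ) : weigh (fun _ => 1) b = size b := by
  simp [weigh, size]

theorem weigh_ne_top {u : S → ℝ≥0∞} (hu : ∀ x, u x ≠ ∞) (b : S →₀ ℕ) : weigh u b ≠ ∞ := by
  rw [weigh_eq_sum]
  exact ENNReal.sum_ne_top.2 fun x _ => ENNReal.mul_ne_top (by simp) (hu x)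

theorem mean_conv_weigh (p q : PMF (S →₀ ℕ)) (u : S → ℝ≥0∞) :
    mean (conv p q) (weigh u) = mean p (weigh u) + mean q (weigh u) := by
  simp only [conv, mean_bind, mean_pure, weigh_add, mean_add, mean_const]

theorem mean_replaceParticles_weigh (f : S → PMF (S →₀ ℕ)) (b : S →₀ ℕ) (u : S → ℝ≥0∞) :
    mean (replaceParticles f b) (weigh u) = weigh (fun x => mean (f x) (weigh u)) b := by
  rw [replaceParticles, weigh]
  induction Finsupp.toMultiset b using Multiset.induction_on with
  | empty => simp [mean_pure, weigh]
  | cons x s ih => rw [Multiset.foldr_cons, mean_conv_weigh, ih, Multiset.map_cons,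
      Multiset.sum_cons]

/-- Expectation is additive over particles, so independence is irrelevant here. -/
theorem mean_brwStep_weigh (b : S →₀ ℕ) (u : S → ℝ≥0∞) :
    mean (brwStep P μ b) (weigh u) = offspringMean μ * weigh (fun x => mean (P x) u) b := by
  simp only [brwStep, mean_bind, mean_replaceParticles_weigh, mean_map, weigh_single, Nat.cast_one,
    one_mul]
  rw [← weigh_const_mul]
  congr 1
  funext x
  rw [mean_mul_const]
  rfl

theorem mean_conv_pow_size (p q : PMF (S →₀ ℕ)) (r : ℝ≥0∞) :
    mean (conv p q) (fun b => r ^ size b)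
      = mean p (fun b => r ^ size b) * mean q (fun b => r ^ size b) := by
  simp only [conv, mean_bind, mean_pure, size, map_add, Multiset.card_add, pow_add,
    mean_const_mul, mean_mul_const]

theorem mean_replaceParticles_pow_size (f : S → PMF (S →₀ ℕ)) (b : S →₀ ℕ) (r : ℝ≥0∞) :
    mean (replaceParticles f b) (fun b => r ^ size b)
      = ((Finsupp.toMultiset b).map fun x => mean (f x) (fun b => r ^ size b)).prod := by
  rw [replaceParticles]
  induction Finsupp.toMultiset b using Multiset.induction_on with
  | empty => simp [mean_pure, size]
  | cons x s ih => rw [Multiset.foldr_cons, mean_conv_pow_size, ih, Multiset.map_cons,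
      Multiset.prod_cons]

/-- Moving does not change the number of particles, and by independence the offspring generating
functions multiply: the size is a Galton–Watson process. -/
theorem mean_brwStep_pow_size (b : S →₀ ℕ) (r : ℝ≥0∞) :
    mean (brwStep P μ b) (fun b => r ^ size b) = (mean μ fun k => r ^ k) ^ size b := by
  have h1 : ∀ (x : S) (k : ℕ), size (Finsupp.single x k) = k := fun x k => by
    simp [size, Finsupp.toMultiset_single]
  simp only [brwStep, mean_bind, mean_replaceParticles_pow_size, mean_map, h1, pow_one,
    mean_const, Multiset.map_const', Multiset.prod_replicate]
  exact (mean_replaceParticles_pow_size _ b r).trans (by simp [mean_map, size])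

variable [Countable S] [MeasurableSpace (S →₀ ℕ)] [DiscreteMeasurableSpace (S →₀ ℕ)]
variable {o : S} {QB : Measure (ℕ → S →₀ ℕ)} [IsProbabilityMeasure QB]

theorem lintegral_weigh (hB : IsPathLaw QB (brwStep P μ) (Finsupp.single o 1)) (n : ℕ)
    (u : S → ℝ≥0∞) :
    ∫⁻ b, weigh u (b n) ∂QB = offspringMean μ ^ n * mean (stepLaw P n o) u := by
  induction n generalizing u with
  | zero =>
    rw [lintegral_congr_ae (g := fun _ => u o) (hB.start.mono fun b hb => by
      simp only [hb, weigh_single, Nat.cast_one, one_mul]), stepLaw, mean_pure]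
    simp
  | succ n ih =>
    rw [hB.lintegral_succ]
    simp only [mean_brwStep_weigh]
    rw [lintegral_const_mul _ (measurable_comp_apply (weigh fun x => mean (P x) u) n), ih,
      stepLaw, mean_bind]
    ring

theorem lintegral_pow_size (hB : IsPathLaw QB (brwStep P μ) (Finsupp.single o 1)) (n : ℕ)
    (r : ℝ≥0∞) :
    ∫⁻ b, r ^ size (b n) ∂QB = (fun t => mean μ fun k => t ^ k)^[n] r := by
  induction n generalizing r with
  | zero =>
    rw [lintegral_congr_ae (g := fun _ => r) (hB.start.mono fun b hb => by
      simp [hb, size, Finsupp.toMultiset_single])]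
    simp
  | succ n ih =>
    rw [hB.lintegral_succ (fun b => r ^ size b)]
    simp only [mean_brwStep_pow_size]
    rw [ih, Function.iterate_succ_apply]

theorem ae_tendsto_weigh_of_superharmonic
    (hB : IsPathLaw QB (brwStep P μ) (Finsupp.single o 1)) (h0 : offspringMean μ ≠ 0)
    (hfin : offspringMean μ ≠ ∞) {u : S → ℝ≥0∞} (hu : ∀ x, u x ≠ ∞)
    (hsup : ∀ x, mean (P x) u ≤ u x) :
    ∀ᵐ b ∂QB, ∃ L ≠ ∞,
      Tendsto (fun n => (offspringMean μ)⁻¹ ^ n * weigh u (b n)) atTop (𝓝 L) := by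
  have hc : (offspringMean μ).toNNReal ≠ 0 := by
    simp [ENNReal.toNNReal_eq_zero_iff, h0, hfin]
  have hcoe : ∀ b, ((weigh u b).toNNReal : ℝ≥0∞) = weigh u b := fun b =>
    ENNReal.coe_toNNReal (weigh_ne_top hu b)
  have h1 := hB.ae_tendsto_of_mean_le hc (g := fun b => (weigh u b).toNNReal) (by
    intro b
    simp only [hcoe, ENNReal.coe_toNNReal hfin, mean_brwStep_weigh]
    exact mul_le_mul_right (weigh_mono hsup b) _)
  filter_upwards [h1] with b ⟨L, hL⟩
  refine ⟨L, ENNReal.coe_ne_top, ?_⟩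
  have h2 := ENNReal.tendsto_coe.2 hL
  simpa only [ENNReal.coe_mul, ENNReal.coe_pow, ENNReal.coe_inv hc, ENNReal.coe_toNNReal hfin,
    hcoe] using h2

theorem lintegral_normalized_weigh (hB : IsPathLaw QB (brwStep P μ) (Finsupp.single o 1))
    (h0 : offspringMean μ ≠ 0) (hfin : offspringMean μ ≠ ∞) (n : ℕ) (u : S → ℝ≥0∞) :
    ∫⁻ b, (offspringMean μ)⁻¹ ^ n * weigh u (b n) ∂QB = mean (stepLaw P n o) u := by
  rw [lintegral_const_mul _ (measurable_comp_apply (weigh u) n), lintegral_weigh hB, ← mul_assoc,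
    ← mul_pow, ENNReal.inv_mul_cancel h0 hfin, one_pow, one_mul]

variable [MeasurableSpace S] [DiscreteMeasurableSpace S] {R : S → Measure (ℕ → S)}
  [∀ y, IsProbabilityMeasure (R y)]

/-- If `φ` tends to zero along the chain, then the normalized sum of `φ` over the particles tends
to zero. -/
theorem ae_tendsto_weigh_zero (hB : IsPathLaw QB (brwStep P μ) (Finsupp.single o 1))
    (h0 : offspringMean μ ≠ 0) (hfin : offspringMean μ ≠ ∞) (hR : ∀ y, IsPathLaw (R y) P y)
    {φ : S → ℝ≥0∞} (hφ : ∀ y, φ y ≤ 1)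
    (hlim : ∀ᵐ w ∂(R o), Tendsto (fun n => φ (w n)) atTop (𝓝 0)) :
    ∀ᵐ b ∂QB, Tendsto (fun n => (offspringMean μ)⁻¹ ^ n * weigh φ (b n)) atTop (𝓝 0) := by
  let v : S → ℝ≥0∞ := fun y => ∫⁻ w, (⨆ k, φ (w k)) ∂(R y)
  have hv1 : ∀ y, v y ≤ 1 := fun y => by
    calc v y ≤ ∫⁻ _, 1 ∂(R y) := lintegral_mono fun w => iSup_le fun k => hφ _
      _ = 1 := by simp
  have hconv := ae_tendsto_weigh_of_superharmonic hB h0 hfin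
    (fun y => ((hv1 y).trans_lt ENNReal.one_lt_top).ne) (mean_lintegral_iSup_le hR φ)
  have hE : Tendsto (fun n => ∫⁻ b, (offspringMean μ)⁻¹ ^ n * weigh v (b n) ∂QB) atTop (𝓝 0) := by
    simp_rw [lintegral_normalized_weigh hB h0 hfin, ← (hR o).lintegral_apply]
    exact (hR o).tendsto_lintegral_iSup hR hφ hlim
  have hm : ∀ n, Measurable fun b : ℕ → S →₀ ℕ => (offspringMean μ)⁻¹ ^ n * weigh v (b n) :=
    fun n => (measurable_comp_apply (weigh v) n).const_mul _
  -- The means tend to zero, so Fatou identifies the almost sure limit, which is already known to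
  -- exist, as zero.
  have hfatou : ∫⁻ b, liminf (fun n => (offspringMean μ)⁻¹ ^ n * weigh v (b n)) atTop ∂QB = 0 := by
    refine le_antisymm ((lintegral_liminf_le hm).trans_eq hE.liminf_eq) zero_le
  rw [lintegral_eq_zero_iff (Measurable.liminf hm)] at hfatou
  filter_upwards [hconv, hfatou] with b ⟨L, _, hL⟩ hb
  rw [hL.liminf_eq] at hb
  simp only [Pi.zero_apply] at hb
  subst hb
  refine tendsto_of_tendsto_of_tendsto_of_le_of_le tendsto_const_nhds hL (fun n => zero_le)
    fun n => ?_
  exact mul_le_mul_right (weigh_mono (le_lintegral_iSup hR φ) _) _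

/-- If `f` converges along the chain, then the normalized sum of `f` over the particles
converges. -/
theorem ae_tendsto_weigh_of_le_one (hB : IsPathLaw QB (brwStep P μ) (Finsupp.single o 1))
    (h0 : offspringMean μ ≠ 0) (hfin : offspringMean μ ≠ ∞) (hR : ∀ y, IsPathLaw (R y) P y)
    {f : S → ℝ≥0∞} (hf : ∀ y, f y ≤ 1)
    (hlim : ∀ᵐ w ∂(R o), ∃ c, Tendsto (fun n => f (w n)) atTop (𝓝 c)) :
    ∀ᵐ b ∂QB, ∃ L ≠ ∞, Tendsto (fun n => (offspringMean μ)⁻¹ ^ n * weigh f (b n)) atTop (𝓝 L) := by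
  -- The limsup is defined and shift-invariant on every path, and agrees with the limit wherever
  -- that exists.
  let F : (ℕ → S) → ℝ≥0∞ := fun w => limsup (fun n => f (w n)) atTop
  have hFm : Measurable F := Measurable.limsup fun n => measurable_comp_apply f n
  have hF1 : ∀ w, F w ≤ 1 := fun w => limsup_le_of_le (h := Eventually.of_forall fun n => hf _)
  let h : S → ℝ≥0∞ := fun y => ∫⁻ w, F w ∂(R y)
  have hh1 : ∀ y, h y ≤ 1 := fun y => by
    calc h y ≤ ∫⁻ _, 1 ∂(R y) := lintegral_mono hF1
      _ = 1 := by simp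
  have hharm : ∀ y, mean (P y) h ≤ h y := fun y => by
    rw [mean_lintegral_eq hR hFm]
    simp only [F, limsup_shift, h, le_refl]
  have hconv := ae_tendsto_weigh_of_superharmonic hB h0 hfin
    (fun y => ((hh1 y).trans_lt ENNReal.one_lt_top).ne) hharm
  -- This is `|f - h|`, written with truncated subtraction.
  let φ : S → ℝ≥0∞ := fun y => (f y - h y) ⊔ (h y - f y)
  have hφ1 : ∀ y, φ y ≤ 1 := fun y =>
    sup_le (tsub_le_self.trans (hf y)) (tsub_le_self.trans (hh1 y))
  have hφ0 : ∀ᵐ w ∂(R o), Tendsto (fun n => φ (w n)) atTop (𝓝 0) := by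
    filter_upwards [hlim, (hR o).ae_tendsto_lintegral hR hFm hF1 (limsup_shift f)] with w ⟨c, hc⟩ hw
    have hcF : F w = c := hc.limsup_eq
    rw [hcF] at hw
    have hc1 : c ≠ ∞ := hcF ▸ ((hF1 w).trans_lt ENNReal.one_lt_top).ne
    have h1 := ENNReal.Tendsto.sub hc hw (Or.inl hc1)
    have h2 := ENNReal.Tendsto.sub hw hc (Or.inl hc1)
    simpa using h1.sup_nhds h2
  filter_upwards [hconv, ae_tendsto_weigh_zero hB h0 hfin hR hφ1 hφ0] with b ⟨L, hL, hbL⟩ hb0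
  refine ⟨L, hL, ?_⟩
  have hup := hbL.add hb0
  have hlow := ENNReal.Tendsto.sub hbL hb0 (Or.inl hL)
  rw [add_zero] at hup
  rw [tsub_zero] at hlow
  refine tendsto_of_tendsto_of_tendsto_of_le_of_le hlow hup (fun n => ?_) fun n => ?_
  · change _ - _ ≤ _
    rw [tsub_le_iff_right, ← mul_add, ← weigh_fun_add]
    exact mul_le_mul_right (weigh_mono (fun y =>
      tsub_le_iff_left.1 (le_sup_right : h y - f y ≤ φ y)) _) _
  · change _ ≤ _ + _
    rw [← mul_add, ← weigh_fun_add]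
    exact mul_le_mul_right (weigh_mono (fun y =>
      tsub_le_iff_left.1 (le_sup_left : f y - h y ≤ φ y)) _) _

theorem ae_tendsto_weigh (hB : IsPathLaw QB (brwStep P μ) (Finsupp.single o 1))
    (h0 : offspringMean μ ≠ 0) (hfin : offspringMean μ ≠ ∞) (hR : ∀ y, IsPathLaw (R y) P y)
    {f : S → ℝ≥0∞} {C : ℝ≥0∞} (hC0 : C ≠ 0) (hC : C ≠ ∞) (hf : ∀ y, f y ≤ C)
    (hlim : ∀ᵐ w ∂(R o), ∃ c, Tendsto (fun n => f (w n)) atTop (𝓝 c)) :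
    ∀ᵐ b ∂QB, ∃ L ≠ ∞, Tendsto (fun n => (offspringMean μ)⁻¹ ^ n * weigh f (b n)) atTop (𝓝 L) := by
  have h1 := ae_tendsto_weigh_of_le_one hB h0 hfin hR (f := fun y => C⁻¹ * f y)
    (fun y => by
      calc C⁻¹ * f y ≤ C⁻¹ * C := mul_le_mul_right (hf y) _
        _ = 1 := ENNReal.inv_mul_cancel hC0 hC)
    (hlim.mono fun w ⟨c, hc⟩ => ⟨C⁻¹ * c, ENNReal.Tendsto.const_mul hc
      (Or.inr (ENNReal.inv_ne_top.2 hC0))⟩)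
  filter_upwards [h1] with b ⟨L, hL, hb⟩
  refine ⟨C * L, ENNReal.mul_ne_top hC hL, ?_⟩
  refine (ENNReal.Tendsto.const_mul hb (Or.inr hC)).congr fun n => ?_
  rw [weigh_const_mul, mul_left_comm, ← mul_assoc C, ENNReal.mul_inv_cancel hC0 hC, one_mul]

end Moments

/-! ### The `L log L` theorem for the total number of particles -/

section KestenStigum

theorem one_sub_pow_le (j : ℕ) {t : ℝ} (h0 : 0 ≤ t) (h1 : t ≤ 1) :
    (1 - t) ^ j ≤ 1 - j * t + j ^ 2 * t ^ 2 := by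
  induction j with
  | zero => simp
  | succ j ih =>
    have h2 : (1 - t) ^ (j + 1) ≤ (1 - j * t + j ^ 2 * t ^ 2) * (1 - t) := by
      rw [pow_succ]
      exact mul_le_mul_of_nonneg_right ih (by linarith)
    have hj : (0 : ℝ) ≤ j := Nat.cast_nonneg j
    have h3 : 0 ≤ (j : ℝ) ^ 2 * t ^ 3 := by positivity
    have h4 : 0 ≤ (j : ℝ) * t ^ 2 := by positivity
    push_cast
    nlinarith [sq_nonneg t]

/-- The loss `j` comes from `(1 - t) ^ j ≤ 1`, the loss `j² s` from the second-order bound. Both are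
needed: the first is integrable against `μ`, the second is small for small `s`. -/
theorem le_one_sub_one_sub_pow (j : ℕ) {t s : ℝ} (h0 : 0 ≤ t) (h1 : t ≤ 1) (hs : t ≤ s) :
    j * t - t * min (j : ℝ) (j ^ 2 * s) ≤ 1 - (1 - t) ^ j := by
  rcases min_cases (j : ℝ) (j ^ 2 * s) with ⟨h, -⟩ | ⟨h, -⟩
  · rw [h]
    have : (1 - t) ^ j ≤ 1 := pow_le_one₀ (by linarith) (by linarith)
    linarith
  · rw [h]
    have h2 := one_sub_pow_le j h0 h1
    have h3 : t * (j ^ 2 * t) ≤ t * (j ^ 2 * s) := by gcongr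
    nlinarith

theorem one_sub_one_sub_pow_le (j : ℕ) {t : ℝ} (h1 : t ≤ 1) : 1 - (1 - t) ^ j ≤ j * t := by
  have := one_add_mul_le_pow (show (-2 : ℝ) ≤ -t by linarith) j
  rw [show 1 + -t = 1 - t by ring] at this
  linarith

/-- The first `log j / log m + O(1)` terms are at most `j` each; from then on `j² m⁻ⁱ` decays
geometrically, starting from at most `j`. This is where `j log j` arises. -/
theorem sum_min_le {m : ℝ} (hm : 1 < m) (j n : ℕ) :
    ∑ i ∈ Finset.range n, min (j : ℝ) (j ^ 2 * (m⁻¹) ^ i)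
      ≤ (1 + (1 - m⁻¹)⁻¹) * j + (Real.log m)⁻¹ * (j * Real.log j) := by
  have hq0 : 0 < m⁻¹ := inv_pos.2 (by linarith)
  have hq1 : m⁻¹ < 1 := inv_lt_one_of_one_lt₀ hm
  have hlm : 0 < Real.log m := Real.log_pos hm
  rcases Nat.eq_zero_or_pos j with rfl | hj
  · simp
  have hj1 : (1 : ℝ) ≤ j := by exact_mod_cast hj
  -- Chosen so that `m ^ N ≥ j`.
  let N := ⌊Real.log j / Real.log m⌋₊ + 1
  have hlj : 0 ≤ Real.log j := Real.log_nonneg hj1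
  have hN1 : (N : ℝ) ≤ Real.log j / Real.log m + 1 := by
    simp only [N, Nat.cast_add, Nat.cast_one]
    gcongr
    exact Nat.floor_le (by positivity)
  have hN2 : (j : ℝ) * (m⁻¹) ^ N ≤ 1 := by
    have h1 : Real.log j ≤ N * Real.log m := by
      rw [← div_le_iff₀ hlm]
      exact (Nat.lt_floor_add_one _).le.trans (by simp [N])
    have h2 : (j : ℝ) ≤ m ^ N := by
      rw [← Real.log_le_log_iff (by linarith) (by positivity), Real.log_pow]
      exact h1
    rw [inv_pow, mul_inv_le_iff₀ (by positivity), one_mul]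
    exact h2
  have hfirst : ∀ k : ℕ, ∑ i ∈ Finset.range k, min (j : ℝ) (j ^ 2 * (m⁻¹) ^ i) ≤ k * j := by
    intro k
    calc ∑ i ∈ Finset.range k, min (j : ℝ) (j ^ 2 * (m⁻¹) ^ i)
        ≤ ∑ _i ∈ Finset.range k, (j : ℝ) := Finset.sum_le_sum fun i _ => min_le_left _ _
      _ = k * j := by simp
  have hsecond : ∀ k : ℕ, ∑ i ∈ Finset.range k, min (j : ℝ) (j ^ 2 * (m⁻¹) ^ (N + i))
      ≤ (1 - m⁻¹)⁻¹ * j := by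
    intro k
    calc ∑ i ∈ Finset.range k, min (j : ℝ) (j ^ 2 * (m⁻¹) ^ (N + i))
        ≤ ∑ i ∈ Finset.range k, (j : ℝ) * (m⁻¹) ^ i := by
          refine Finset.sum_le_sum fun i _ => (min_le_right _ _).trans ?_
          have h3 : 0 ≤ (j : ℝ) * (m⁻¹) ^ i := by positivity
          calc (j : ℝ) ^ 2 * (m⁻¹) ^ (N + i) = ((j : ℝ) * (m⁻¹) ^ i) * (j * (m⁻¹) ^ N) := by ring
            _ ≤ ((j : ℝ) * (m⁻¹) ^ i) * 1 := by gcongr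
            _ = _ := mul_one _
      _ = j * ∑ i ∈ Finset.range k, (m⁻¹) ^ i := by rw [Finset.mul_sum]
      _ ≤ j * (1 - m⁻¹)⁻¹ := by
          gcongr
          rw [← tsum_geometric_of_lt_one hq0.le hq1]
          exact (summable_geometric_of_lt_one hq0.le hq1).sum_le_tsum _ fun i _ => by positivity
      _ = (1 - m⁻¹)⁻¹ * j := mul_comm _ _
  have hNj : (N : ℝ) * j ≤ j + (Real.log m)⁻¹ * (j * Real.log j) := by
    calc (N : ℝ) * j ≤ (Real.log j / Real.log m + 1) * j := by gcongr
      _ = _ := by field_simp; ring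
  rcases le_total n N with hn | hn
  · have h3 : (n : ℝ) * j ≤ N * j := by gcongr
    have h4 : 0 ≤ (1 - m⁻¹)⁻¹ * j := by
      have : 0 < 1 - m⁻¹ := by linarith
      positivity
    linarith [hfirst n]
  · obtain ⟨k, rfl⟩ := Nat.exists_eq_add_of_le hn
    rw [Finset.sum_range_add]
    linarith [hfirst N, hsecond k]

/-- The probability generating function of the offspring law. -/
def genFun (μ : PMF ℕ) (r : ℝ) : ℝ := ∑' k, (μ k).toReal * r ^ k

/-- An upper bound for the relative defect of linearity of the generating function near one. -/
def defect (μ : PMF ℕ) (s : ℝ) : ℝ := ∑' k : ℕ, (μ k).toReal * min (k : ℝ) (k ^ 2 * s)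

variable {μ : PMF ℕ}

theorem hasSum_toReal (μ : PMF ℕ) : HasSum (fun k => (μ k).toReal) 1 := by
  have h1 : ∑' k, μ k ≠ ∞ := by simp [PMF.tsum_coe]
  have h2 := (ENNReal.summable_toReal h1).hasSum
  rwa [← ENNReal.tsum_toReal_eq (fun k => μ.apply_ne_top k), PMF.tsum_coe,
    ENNReal.toReal_one] at h2

theorem hasSum_mean (hfin : offspringMean μ ≠ ∞) :
    HasSum (fun k : ℕ => (μ k).toReal * k) (offspringMean μ).toReal := by
  have h2 := (ENNReal.summable_toReal hfin).hasSum
  rw [← ENNReal.tsum_toReal_eq (fun k => ENNReal.mul_ne_top (μ.apply_ne_top k) (by simp))] at h2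
  simpa [ENNReal.toReal_mul, offspringMean] using h2

theorem summable_genFun (μ : PMF ℕ) {r : ℝ} (h0 : 0 ≤ r) (h1 : r ≤ 1) :
    Summable fun k => (μ k).toReal * r ^ k :=
  Summable.of_nonneg_of_le (fun k => by positivity)
    (fun k => mul_le_of_le_one_right ENNReal.toReal_nonneg (pow_le_one₀ h0 h1))
    (hasSum_toReal μ).summable

theorem genFun_mem (μ : PMF ℕ) {r : ℝ} (h : r ∈ Set.Icc (0 : ℝ) 1) :
    genFun μ r ∈ Set.Icc (0 : ℝ) 1 := by
  obtain ⟨h0, h1⟩ := h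
  refine ⟨tsum_nonneg fun k => by positivity, ?_⟩
  rw [← (hasSum_toReal μ).tsum_eq]
  exact (summable_genFun μ h0 h1).tsum_le_tsum
    (fun k => mul_le_of_le_one_right ENNReal.toReal_nonneg (pow_le_one₀ h0 h1))
    (hasSum_toReal μ).summable

theorem ofReal_genFun (μ : PMF ℕ) {r : ℝ} (h : r ∈ Set.Icc (0 : ℝ) 1) :
    ENNReal.ofReal (genFun μ r) = mean μ fun k => ENNReal.ofReal r ^ k := by
  obtain ⟨h0, h1⟩ := h
  rw [genFun, ENNReal.ofReal_tsum_of_nonneg (fun k => by positivity) (summable_genFun μ h0 h1),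
    mean]
  refine tsum_congr fun k => ?_
  rw [ENNReal.ofReal_mul ENNReal.toReal_nonneg, ENNReal.ofReal_toReal (μ.apply_ne_top k),
    ENNReal.ofReal_pow h0]

theorem iterate_genFun_mem (μ : PMF ℕ) {r : ℝ} (h : r ∈ Set.Icc (0 : ℝ) 1) (n : ℕ) :
    (genFun μ)^[n] r ∈ Set.Icc (0 : ℝ) 1 := by
  induction n with
  | zero => exact h
  | succ n ih => rw [Function.iterate_succ_apply']; exact genFun_mem μ ih

theorem ofReal_iterate_genFun (μ : PMF ℕ) {r : ℝ} (h : r ∈ Set.Icc (0 : ℝ) 1) (n : ℕ) :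
    ENNReal.ofReal ((genFun μ)^[n] r)
      = (fun t => mean μ fun k => t ^ k)^[n] (ENNReal.ofReal r) := by
  induction n with
  | zero => rfl
  | succ n ih =>
    rw [Function.iterate_succ_apply', Function.iterate_succ_apply',
      ofReal_genFun μ (iterate_genFun_mem μ h n), ih]

theorem summable_defect (hfin : offspringMean μ ≠ ∞) {s : ℝ} (hs : 0 ≤ s) :
    Summable fun k : ℕ => (μ k).toReal * min (k : ℝ) (k ^ 2 * s) :=
  Summable.of_nonneg_of_le (fun k => by positivity)
    (fun k => mul_le_mul_of_nonneg_left (min_le_left _ _) ENNReal.toReal_nonneg)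
    (hasSum_mean hfin).summable

theorem defect_nonneg (μ : PMF ℕ) {s : ℝ} (hs : 0 ≤ s) : 0 ≤ defect μ s :=
  tsum_nonneg fun k => by positivity

theorem hasSum_one_sub_genFun (μ : PMF ℕ) {t : ℝ} (h0 : 0 ≤ t) (h1 : t ≤ 1) :
    HasSum (fun k => (μ k).toReal * (1 - (1 - t) ^ k)) (1 - genFun μ (1 - t)) := by
  have := (hasSum_toReal μ).sub (summable_genFun μ (r := 1 - t) (by linarith) (by linarith)).hasSum
  simpa only [mul_sub, mul_one, genFun] using this

theorem one_sub_genFun_le (hfin : offspringMean μ ≠ ∞) {t : ℝ} (h0 : 0 ≤ t) (h1 : t ≤ 1) :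
    1 - genFun μ (1 - t) ≤ (offspringMean μ).toReal * t := by
  refine hasSum_le (fun k => ?_) (hasSum_one_sub_genFun μ h0 h1) ((hasSum_mean hfin).mul_right t)
  rw [mul_assoc]
  exact mul_le_mul_of_nonneg_left (one_sub_one_sub_pow_le k h1) ENNReal.toReal_nonneg

theorem le_one_sub_genFun (hfin : offspringMean μ ≠ ∞) {t s : ℝ} (h0 : 0 ≤ t) (h1 : t ≤ 1)
    (hs : t ≤ s) :
    (offspringMean μ).toReal * t - t * defect μ s ≤ 1 - genFun μ (1 - t) := by
  refine hasSum_le (fun k => ?_) (((hasSum_mean hfin).mul_right t).sub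
    ((summable_defect hfin (h0.trans hs)).hasSum.mul_left t)) (hasSum_one_sub_genFun μ h0 h1)
  have := mul_le_mul_of_nonneg_left (le_one_sub_one_sub_pow k h0 h1 hs)
    (ENNReal.toReal_nonneg (a := μ k))
  calc _ = (μ k).toReal * (k * t - t * min (k : ℝ) (k ^ 2 * s)) := by ring
    _ ≤ _ := this

/-- Interchange the sums over `i` and `k` and apply `sum_min_le` for each `k`; the resulting bound
is summable precisely thanks to the `L log L` condition. -/
theorem summable_defect_pow (hfin : offspringMean μ ≠ ∞) (hm : 1 < (offspringMean μ).toReal)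
    (hL : LLogL μ) : Summable fun i : ℕ => defect μ ((offspringMean μ).toReal⁻¹ ^ i) := by
  set m := (offspringMean μ).toReal with hmdef
  have hq0 : 0 ≤ m⁻¹ := inv_nonneg.2 (by linarith)
  have hbound : Summable fun k : ℕ => (μ k).toReal *
      ((1 + (1 - m⁻¹)⁻¹) * k + (Real.log m)⁻¹ * (k * Real.log k)) := by
    have := ((hasSum_mean hfin).summable.mul_left (1 + (1 - m⁻¹)⁻¹)).add
      (hL.mul_left (Real.log m)⁻¹)
    refine this.congr fun k => ?_
    ring
  refine summable_of_sum_range_le (fun i => defect_nonneg μ (pow_nonneg hq0 i)) (c := ∑' k : ℕ,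
    (μ k).toReal * ((1 + (1 - m⁻¹)⁻¹) * k + (Real.log m)⁻¹ * (k * Real.log k))) fun n => ?_
  simp only [defect]
  rw [← Summable.tsum_finsetSum fun i _ => summable_defect hfin (pow_nonneg hq0 i)]
  refine Summable.tsum_le_tsum (fun k => ?_)
    (summable_sum fun i _ => summable_defect hfin (pow_nonneg hq0 i)) hbound
  rw [← Finset.mul_sum]
  exact mul_le_mul_of_nonneg_left (sum_min_le hm k n) ENNReal.toReal_nonneg

/-- Lower bound for the iterates of the generating function near one. -/
theorem le_one_sub_iterate_genFun (hfin : offspringMean μ ≠ ∞)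
    (hm : 1 < (offspringMean μ).toReal) {t : ℝ} (h0 : 0 ≤ t) (h1 : t ≤ 1) {J n : ℕ}
    (ht : t ≤ (offspringMean μ).toReal⁻¹ ^ (J + n)) {k : ℕ} (hk : k ≤ n) :
    (offspringMean μ).toReal⁻¹ ^ k * (1 - (genFun μ)^[k] (1 - t)) ≤ t ∧
    t * (1 - (offspringMean μ).toReal⁻¹ *
        ∑ i ∈ Finset.range k, defect μ ((offspringMean μ).toReal⁻¹ ^ (J + n - i)))
      ≤ (offspringMean μ).toReal⁻¹ ^ k * (1 - (genFun μ)^[k] (1 - t)) := by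
  set m := (offspringMean μ).toReal with hmdef
  have hm0 : 0 < m := by linarith
  have hq0 : 0 < m⁻¹ := inv_pos.2 hm0
  induction k with
  | zero => simp
  | succ k ih =>
    obtain ⟨ih1, ih2⟩ := ih (by omega)
    have hmem := iterate_genFun_mem μ (r := 1 - t) ⟨by linarith, by linarith⟩ k
    set u := 1 - (genFun μ)^[k] (1 - t) with hu
    have hu0 : 0 ≤ u := by linarith [hmem.2]
    have hu1 : u ≤ 1 := by linarith [hmem.1]
    have hit : (genFun μ)^[k + 1] (1 - t) = genFun μ (1 - u) := by
      rw [Function.iterate_succ_apply', hu]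
      ring_nf
    rw [hit]
    -- The upper bound of the induction controls how far the iterate has moved from one, and so at
    -- which scale the defect of the next step is evaluated.
    have hus : u ≤ m⁻¹ ^ (J + n - k) := by
      have h2 : m⁻¹ ^ k * u ≤ m⁻¹ ^ k * m⁻¹ ^ (J + n - k) := by
        rw [← pow_add, show k + (J + n - k) = J + n by omega]
        exact ih1.trans ht
      exact le_of_mul_le_mul_left h2 (pow_pos hq0 k)
    have hup := one_sub_genFun_le hfin hu0 hu1
    have hlow := le_one_sub_genFun hfin hu0 hu1 hus
    rw [← hmdef] at hup hlow
    have hqm : m⁻¹ * m = 1 := inv_mul_cancel₀ hm0.ne'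
    have hpk : 0 < m⁻¹ ^ k := pow_pos hq0 k
    have hE := defect_nonneg μ (pow_nonneg hq0.le (J + n - k))
    constructor
    · calc m⁻¹ ^ (k + 1) * (1 - genFun μ (1 - u)) ≤ m⁻¹ ^ (k + 1) * (m * u) := by gcongr
        _ = m⁻¹ ^ k * u * (m⁻¹ * m) := by ring
        _ ≤ t := by rw [hqm, mul_one]; exact ih1
    · rw [Finset.sum_range_succ]
      calc t * (1 - m⁻¹ * (∑ i ∈ Finset.range k, defect μ (m⁻¹ ^ (J + n - i))
              + defect μ (m⁻¹ ^ (J + n - k))))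
          = t * (1 - m⁻¹ * ∑ i ∈ Finset.range k, defect μ (m⁻¹ ^ (J + n - i)))
            - m⁻¹ * (t * defect μ (m⁻¹ ^ (J + n - k))) := by ring
        _ ≤ m⁻¹ ^ k * u - m⁻¹ * (m⁻¹ ^ k * u * defect μ (m⁻¹ ^ (J + n - k))) := by gcongr
        _ = m⁻¹ ^ k * u * (m⁻¹ * m) - m⁻¹ * (m⁻¹ ^ k * u * defect μ (m⁻¹ ^ (J + n - k))) := by
            rw [hqm, mul_one]
        _ = m⁻¹ ^ (k + 1) * (m * u - u * defect μ (m⁻¹ ^ (J + n - k))) := by ring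
        _ ≤ m⁻¹ ^ (k + 1) * (1 - genFun μ (1 - u)) := by gcongr

/-- Difference quotients at zero of `1 - exp (-s x)`, along `x = m⁻ⁿ`. -/
theorem tendsto_pow_mul_one_sub_exp {m : ℝ} (hm : 1 < m) (s : ℝ) :
    Tendsto (fun n : ℕ => m ^ n * (1 - Real.exp (-(s * m⁻¹ ^ n)))) atTop (𝓝 s) := by
  have hd : HasDerivAt (fun x : ℝ => 1 - Real.exp (-(s * x))) s 0 := by
    have h1 : HasDerivAt (fun x : ℝ => -(s * x)) (-(s * 1)) 0 := ((hasDerivAt_id 0).const_mul s).neg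
    have h2 := (h1.exp).const_sub 1
    simpa using h2
  have hq : Tendsto (fun n : ℕ => m⁻¹ ^ n) atTop (𝓝[≠] 0) := by
    refine tendsto_nhdsWithin_iff.2 ⟨tendsto_pow_atTop_nhds_zero_of_lt_one
      (inv_nonneg.2 (by linarith)) (inv_lt_one_of_one_lt₀ hm), Eventually.of_forall fun n => ?_⟩
    exact pow_ne_zero n (inv_ne_zero (by linarith))
  have h3 := (hasDerivAt_iff_tendsto_slope.1 hd).comp hq
  refine h3.congr fun n => ?_
  simp [slope_def_field, div_eq_mul_inv, mul_comm]

/-- For `i < n` the exponents run through `J + 1, …, J + n`, so the sum is bounded, uniformly in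
`n`, by a tail of a convergent series. -/
theorem exists_sum_defect_le (hfin : offspringMean μ ≠ ∞) (hm : 1 < (offspringMean μ).toReal)
    (hL : LLogL μ) {ε : ℝ} (hε : 0 < ε) :
    ∃ J : ℕ, ∀ n, ∑ i ∈ Finset.range n,
      defect μ ((offspringMean μ).toReal⁻¹ ^ (J + n - i)) ≤ ε := by
  have hsum := summable_defect_pow hfin hm hL
  have hnn : ∀ i : ℕ, 0 ≤ defect μ ((offspringMean μ).toReal⁻¹ ^ i) := fun i =>
    defect_nonneg μ (pow_nonneg (inv_nonneg.2 (by linarith)) i)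
  obtain ⟨J, hJ⟩ := ((tendsto_order.1
    (tendsto_sum_nat_add fun i => defect μ ((offspringMean μ).toReal⁻¹ ^ i))).2 ε hε).exists
  refine ⟨J, fun n => ?_⟩
  have hs2 := (summable_nat_add_iff J).2 hsum
  calc ∑ i ∈ Finset.range n, defect μ ((offspringMean μ).toReal⁻¹ ^ (J + n - i))
      = ∑ i ∈ Finset.range n, defect μ ((offspringMean μ).toReal⁻¹ ^ (i + 1 + J)) := by
        rw [← Finset.sum_range_reflect]
        refine Finset.sum_congr rfl fun i hi => ?_
        have := Finset.mem_range.1 hi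
        congr 2
        omega
    _ ≤ ∑ i ∈ Finset.range (n + 1), defect μ ((offspringMean μ).toReal⁻¹ ^ (i + J)) := by
        rw [Finset.sum_range_succ']
        linarith [hnn (0 + J)]
    _ ≤ ∑' i, defect μ ((offspringMean μ).toReal⁻¹ ^ (i + J)) :=
        hs2.sum_le_tsum _ fun i _ => hnn _
    _ ≤ ε := hJ.le

variable {S : Type*} {P : S → PMF S} {o : S} [Countable S] [MeasurableSpace (S →₀ ℕ)]
  [DiscreteMeasurableSpace (S →₀ ℕ)] {QB : Measure (ℕ → S →₀ ℕ)} [IsProbabilityMeasure QB]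

/-- Under the `L log L` condition the normalized number of particles loses no mass in the
limit. -/
theorem one_le_lintegral_of_tendsto_size
    (hB : IsPathLaw QB (brwStep P μ) (Finsupp.single o 1)) (hsuper : 1 < offspringMean μ)
    (hfin : offspringMean μ ≠ ∞) (hL : LLogL μ) {W : (ℕ → S →₀ ℕ) → ℝ≥0∞}
    (hW : ∀ᵐ b ∂QB, W b ≠ ∞ ∧
      Tendsto (fun n => (offspringMean μ)⁻¹ ^ n * (size (b n) : ℝ≥0∞)) atTop (𝓝 (W b))) :
    1 ≤ ∫⁻ b, W b ∂QB := by
  have hm : 1 < (offspringMean μ).toReal := by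
    rw [← ENNReal.toReal_one]
    exact (ENNReal.toReal_lt_toReal ENNReal.one_ne_top hfin).2 hsuper
  set m := (offspringMean μ).toReal with hmdef
  have hm0 : 0 < m := by linarith
  have hq0 : 0 < m⁻¹ := inv_pos.2 hm0
  have key : ∀ ε : ℝ, 0 < ε → ENNReal.ofReal (1 - m⁻¹ * ε) ≤ ∫⁻ b, W b ∂QB := by
    intro ε hε
    obtain ⟨J, hJ⟩ := exists_sum_defect_le hfin hm hL hε
    rw [← hmdef] at hJ
    -- With this `s`, the starting distance `1 - exp (-s m⁻ⁿ)` from one is at most `m⁻¹ ^ (J + n)`,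
    -- as the iteration bound requires. Letting `n → ∞` gives `E[1 - exp (-s W)] ≥ s (1 - ε / m)`,
    -- and `1 - exp (-x) ≤ x` turns this into `E[W] ≥ 1 - ε / m`.
    let s : ℝ := m⁻¹ ^ J
    have hs0 : 0 < s := pow_pos hq0 J
    let F : ℕ → (ℕ → S →₀ ℕ) → ℝ≥0∞ := fun n b =>
      ENNReal.ofReal (1 - Real.exp (-(s * m⁻¹ ^ n)) ^ size (b n))
    have hexp : ∀ n, Real.exp (-(s * m⁻¹ ^ n)) ∈ Set.Icc (0 : ℝ) 1 := fun n =>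
      ⟨(Real.exp_pos _).le, Real.exp_le_one_iff.2 (by
        have : 0 ≤ s * m⁻¹ ^ n := by positivity
        linarith)⟩
    have hFm : ∀ n, Measurable (F n) := fun n =>
      measurable_comp_apply (fun b : S →₀ ℕ =>
        ENNReal.ofReal (1 - Real.exp (-(s * m⁻¹ ^ n)) ^ size b)) n
    have hFint : ∀ n, ∫⁻ b, F n b ∂QB
        = ENNReal.ofReal (1 - (genFun μ)^[n] (Real.exp (-(s * m⁻¹ ^ n)))) := by
      intro n
      have h1 : ∀ b : ℕ → S →₀ ℕ, F n b
          = 1 - ENNReal.ofReal (Real.exp (-(s * m⁻¹ ^ n))) ^ size (b n) := fun b => by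
        simp only [F]
        rw [ENNReal.ofReal_sub _ (pow_nonneg (hexp n).1 _), ENNReal.ofReal_one,
          ENNReal.ofReal_pow (hexp n).1]
      have h2 := lintegral_pow_size hB n (ENNReal.ofReal (Real.exp (-(s * m⁻¹ ^ n))))
      rw [← ofReal_iterate_genFun μ (hexp n)] at h2
      simp only [h1]
      rw [lintegral_sub (measurable_comp_apply (fun b : S →₀ ℕ =>
          ENNReal.ofReal (Real.exp (-(s * m⁻¹ ^ n))) ^ size b) n)
          (by rw [h2]; exact ENNReal.ofReal_ne_top)
          (ae_of_all _ fun b => pow_le_one₀ zero_le (ENNReal.ofReal_le_one.2 (hexp n).2)), h2,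
        ENNReal.ofReal_sub _ (iterate_genFun_mem μ (hexp n) n).1]
      simp
    have hlim : Tendsto (fun n => ∫⁻ b, F n b ∂QB) atTop
        (𝓝 (∫⁻ b, ENNReal.ofReal (1 - Real.exp (-(s * (W b).toReal))) ∂QB)) := by
      refine tendsto_lintegral_of_dominated_convergence (fun _ => 1) hFm
        (fun n => ae_of_all _ fun b => ?_) (by simp) ?_
      · refine ENNReal.ofReal_le_one.2 ?_
        have := pow_nonneg (hexp n).1 (size (b n))
        linarith
      · filter_upwards [hW] with b ⟨hb1, hb2⟩
        have h3 : Tendsto (fun n => m⁻¹ ^ n * (size (b n) : ℝ)) atTop (𝓝 (W b).toReal) := by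
          have h4 := (ENNReal.tendsto_toReal hb1).comp hb2
          refine h4.congr fun n => ?_
          simp [hmdef]
        refine ENNReal.tendsto_ofReal ?_
        have h5 := ((Real.continuous_exp.tendsto _).comp ((h3.const_mul s).neg)).const_sub 1
        refine h5.congr fun n => ?_
        simp only [Function.comp_apply]
        rw [← Real.exp_nat_mul]
        congr 2
        ring
    have hlow : ∀ n, ENNReal.ofReal (m ^ n * (1 - Real.exp (-(s * m⁻¹ ^ n))) * (1 - m⁻¹ * ε))
        ≤ ∫⁻ b, F n b ∂QB := by
      intro n
      rw [hFint]
      refine ENNReal.ofReal_le_ofReal ?_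
      set t := 1 - Real.exp (-(s * m⁻¹ ^ n)) with ht
      have ht0 : 0 ≤ t := by linarith [(hexp n).2]
      have ht1 : t ≤ 1 := by linarith [(hexp n).1]
      have hts : t ≤ m⁻¹ ^ (J + n) := by
        have := Real.add_one_le_exp (-(s * m⁻¹ ^ n))
        rw [pow_add]
        change t ≤ s * m⁻¹ ^ n
        linarith
      have h6 := (le_one_sub_iterate_genFun hfin hm ht0 ht1 hts le_rfl).2
      rw [← hmdef, show 1 - t = Real.exp (-(s * m⁻¹ ^ n)) by rw [ht]; ring] at h6
      have h7 : t * (1 - m⁻¹ * ε)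
          ≤ m⁻¹ ^ n * (1 - (genFun μ)^[n] (Real.exp (-(s * m⁻¹ ^ n)))) := by
        refine le_trans ?_ h6
        gcongr
        exact hJ n
      calc m ^ n * t * (1 - m⁻¹ * ε) = m ^ n * (t * (1 - m⁻¹ * ε)) := by ring
        _ ≤ m ^ n * (m⁻¹ ^ n * (1 - (genFun μ)^[n] (Real.exp (-(s * m⁻¹ ^ n))))) := by gcongr
        _ = _ := by rw [← mul_assoc, ← mul_pow, mul_inv_cancel₀ hm0.ne', one_pow, one_mul]
    have h8 := le_of_tendsto_of_tendsto'
      (ENNReal.tendsto_ofReal ((tendsto_pow_mul_one_sub_exp hm s).mul_const (1 - m⁻¹ * ε)))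
      hlim hlow
    have h9 : ∫⁻ b, ENNReal.ofReal (1 - Real.exp (-(s * (W b).toReal))) ∂QB
        ≤ ENNReal.ofReal s * ∫⁻ b, W b ∂QB := by
      rw [← lintegral_const_mul' _ _ ENNReal.ofReal_ne_top]
      refine lintegral_mono fun b => ?_
      calc ENNReal.ofReal (1 - Real.exp (-(s * (W b).toReal)))
          ≤ ENNReal.ofReal (s * (W b).toReal) := ENNReal.ofReal_le_ofReal (by
            linarith [Real.add_one_le_exp (-(s * (W b).toReal))])
        _ = ENNReal.ofReal s * ENNReal.ofReal (W b).toReal := ENNReal.ofReal_mul hs0.le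
        _ ≤ ENNReal.ofReal s * W b := mul_le_mul_right ENNReal.ofReal_toReal_le _
    have h10 := h8.trans h9
    rw [ENNReal.ofReal_mul hs0.le] at h10
    exact (ENNReal.mul_le_mul_iff_right (ENNReal.ofReal_pos.2 hs0).ne'
      ENNReal.ofReal_ne_top).1 h10
  have hlim : Tendsto (fun n : ℕ => ENNReal.ofReal (1 - m⁻¹ * (1 / ((n : ℝ) + 1)))) atTop (𝓝 1) := by
    have := ENNReal.tendsto_ofReal
      ((tendsto_one_div_add_atTop_nhds_zero_nat.const_mul m⁻¹).const_sub 1)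
    simpa using this
  exact le_of_tendsto' hlim fun n => key _ (by positivity)

end KestenStigum

/-! ### Random weak limits of finite measures on a compact space -/

section WeakLimit

open BoundedContinuousFunction

variable {X : Type*} [TopologicalSpace X] [MeasurableSpace X] [BorelSpace X]

theorem exists_denseRange_boundedContinuous (X : Type*) [TopologicalSpace X] [CompactSpace X]
    [T2Space X] [SecondCountableTopology X] : ∃ f : ℕ → (X →ᵇ ℝ≥0), DenseRange f := by
  let e := ContinuousMap.isometryEquivBoundedOfCompact X ℝ≥0
  refine ⟨fun n => e (TopologicalSpace.denseSeq C(X, ℝ≥0) n), ?_⟩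
  exact e.surjective.denseRange.comp (TopologicalSpace.denseRange_denseSeq _) e.continuous

theorem finiteMeasure_ext_of_denseRange [HasOuterApproxClosed X] {f : ℕ → (X →ᵇ ℝ≥0)}
    (hf : DenseRange f) {ν ν' : FiniteMeasure X}
    (h : ∀ i, ν.testAgainstNN (f i) = ν'.testAgainstNN (f i)) : ν = ν' := by
  have hfun : (fun g => ν.testAgainstNN g) = fun g => ν'.testAgainstNN g :=
    hf.equalizer ν.testAgainstNN_lipschitz.continuous ν'.testAgainstNN_lipschitz.continuous
      (funext h)
  refine FiniteMeasure.ext_of_forall_lintegral_eq fun g => ?_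
  rw [← FiniteMeasure.testAgainstNN_coe_eq, ← FiniteMeasure.testAgainstNN_coe_eq,
    congrFun hfun g]

/-- Convergent masses keep the sequence eventually in a compact set of measures, and the limits
against the dense family leave room for only one cluster point. -/
theorem exists_tendsto_finiteMeasure [CompactSpace X] [T2Space X] [HasOuterApproxClosed X]
    {f : ℕ → (X →ᵇ ℝ≥0)} (hf : DenseRange f) {ν : ℕ → FiniteMeasure X}
    (h1 : ∃ L, Tendsto (fun n => (ν n).mass) atTop (𝓝 L))
    (h : ∀ i, ∃ L, Tendsto (fun n => (ν n).testAgainstNN (f i)) atTop (𝓝 L)) :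
    ∃ ν', Tendsto ν atTop (𝓝 ν') := by
  obtain ⟨L, hL⟩ := h1
  have hbdd : ∀ᶠ n in atTop, ν n ∈ {ν' : FiniteMeasure X | ν'.mass ≤ L + 1} :=
    (hL.eventually (gt_mem_nhds (lt_add_one L))).mono fun n hn => hn.le
  have hK := isCompact_setOfPred_finiteMeasure_le_of_compactSpace X (L + 1)
  obtain ⟨ν', -, hν'⟩ := hK.exists_mapClusterPt_of_frequently hbdd.frequently
  refine ⟨ν', hK.tendsto_nhds_of_unique_mapClusterPt hbdd fun ν'' _ hν'' => ?_⟩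
  refine finiteMeasure_ext_of_denseRange hf fun i => ?_
  obtain ⟨l, hl⟩ := h i
  have key : ∀ ρ, MapClusterPt ρ atTop ν → ρ.testAgainstNN (f i) = l := fun ρ hρ => by
    have h2 : MapClusterPt (ρ.testAgainstNN (f i)) atTop fun n => (ν n).testAgainstNN (f i) :=
      hρ.continuousAt_comp (FiniteMeasure.continuous_testAgainstNN_eval (f i)).continuousAt
    by_contra hne
    obtain ⟨U, V, hU, hV, hUV⟩ := t2_separation_nhds hne
    obtain ⟨n, hn1, hn2⟩ := ((h2.frequently hU).and_eventually (hl hV)).exists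
    exact Set.disjoint_left.1 hUV hn1 hn2
  rw [key ν'' hν'', key ν' hν']

variable {Ω : Type*} [MeasurableSpace Ω]

/-- Closed sets form a π-system generating the Borel sets, and their indicators are limits of
continuous functions. -/
theorem measurable_measure_of_lintegral [HasOuterApproxClosed X] {W : Ω → FiniteMeasure X}
    (h : ∀ f : X →ᵇ ℝ≥0, Measurable fun ω => ∫⁻ x, f x ∂(W ω : Measure X)) :
    Measurable fun ω => (W ω : Measure X) := by
  have hclosed : ∀ F : Set X, IsClosed F → Measurable fun ω => (W ω : Measure X) F := fun F hF =>
    measurable_of_tendsto_metrizable (fun n => h (hF.apprSeq n))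
      (tendsto_pi_nhds.2 fun ω => HasOuterApproxClosed.tendsto_lintegral_apprSeq hF _)
  refine Measurable.measure_of_isPiSystem (S := {F | IsClosed F}) ?_ ?_ (fun F hF => hclosed F hF)
    (hclosed _ isClosed_univ)
  · rw [BorelSpace.measurable_eq (α := X), borel_eq_generateFrom_isClosed]
  · intro F hF G hG _
    exact IsClosed.inter hF hG

theorem exists_measurable_weak_limit [CompactSpace X] [T2Space X] [SecondCountableTopology X]
    [HasOuterApproxClosed X] {ℙ : Measure Ω} {ν : ℕ → Ω → FiniteMeasure X}
    (hmeas : ∀ n (f : X →ᵇ ℝ≥0), Measurable fun ω => (ν n ω).testAgainstNN f)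
    (hconv : ∀ f : X →ᵇ ℝ≥0,
      ∀ᵐ ω ∂ℙ, ∃ L, Tendsto (fun n => (ν n ω).testAgainstNN f) atTop (𝓝 L)) :
    ∃ W : Ω → FiniteMeasure X, Measurable (fun ω => (W ω : Measure X)) ∧
      ∀ᵐ ω ∂ℙ, Tendsto (fun n => ν n ω) atTop (𝓝 (W ω)) := by
  classical
  obtain ⟨f, hf⟩ := exists_denseRange_boundedContinuous X
  -- Only countably many convergences are required, so `G` is measurable and has full measure; `W`
  -- is set to zero off `G`.
  let G : Set Ω := {ω | ∃ L, Tendsto (fun n => (ν n ω).testAgainstNN 1) atTop (𝓝 L)} ∩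
    ⋂ i, {ω | ∃ L, Tendsto (fun n => (ν n ω).testAgainstNN (f i)) atTop (𝓝 L)}
  have hG : MeasurableSet G :=
    (measurableSet_exists_tendsto fun n => hmeas n 1).inter
      (MeasurableSet.iInter fun i => measurableSet_exists_tendsto fun n => hmeas n (f i))
  have hlim : ∀ ω ∈ G, ∃ ν', Tendsto (fun n => ν n ω) atTop (𝓝 ν') := by
    rintro ω ⟨h1, h2⟩
    refine exists_tendsto_finiteMeasure hf ?_ fun i => Set.mem_iInter.1 h2 i
    simpa only [FiniteMeasure.testAgainstNN_one, Set.mem_ofPred_eq] using h1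
  let W : Ω → FiniteMeasure X := fun ω => if h : ω ∈ G then (hlim ω h).choose else 0
  have hW : ∀ ω ∈ G, Tendsto (fun n => ν n ω) atTop (𝓝 (W ω)) := fun ω hω => by
    simp only [W, dif_pos hω]
    exact (hlim ω hω).choose_spec
  refine ⟨W, measurable_measure_of_lintegral fun g => ?_, ?_⟩
  · refine measurable_of_tendsto_metrizable
      (f := fun n => G.indicator fun ω => ((ν n ω).testAgainstNN g : ℝ≥0∞))
      (fun n => ((hmeas n g).coe_nnreal_ennreal).indicator hG) (tendsto_pi_nhds.2 fun ω => ?_)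
    by_cases hω : ω ∈ G
    · simp only [Set.indicator_of_mem hω, FiniteMeasure.testAgainstNN_coe_eq]
      exact FiniteMeasure.tendsto_iff_forall_lintegral_tendsto.1 (hW ω hω) g
    · simp [W, hω]
  · have hae : ∀ᵐ ω ∂ℙ, ω ∈ G := by
      filter_upwards [hconv 1, ae_all_iff.2 fun i => hconv (f i)] with ω h1 h2
      exact ⟨h1, Set.mem_iInter.2 h2⟩
    filter_upwards [hae] with ω hω
    exact hW ω hω

/-- Inner regularity reduces to closed sets, and these to continuous approximations of their
indicators. -/
theorem measure_le_of_forall_lintegral_le [HasOuterApproxClosed X] {ρ ρ' : Measure X}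
    [IsFiniteMeasure ρ] [IsFiniteMeasure ρ'] [ρ.WeaklyRegular]
    (h : ∀ f : X →ᵇ ℝ≥0, ∫⁻ x, f x ∂ρ ≤ ∫⁻ x, f x ∂ρ') {A : Set X} (hA : MeasurableSet A) :
    ρ A ≤ ρ' A := by
  rw [hA.measure_eq_iSup_isClosed_of_ne_top (measure_ne_top ρ A)]
  refine iSup_le fun F => iSup_le fun hFA => iSup_le fun hF => ?_
  refine le_trans ?_ (measure_mono hFA)
  exact le_of_tendsto_of_tendsto' (HasOuterApproxClosed.tendsto_lintegral_apprSeq hF ρ)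
    (HasOuterApproxClosed.tendsto_lintegral_apprSeq hF ρ') fun n => h _

end WeakLimit

/-! ### Branching random walk on the Martin compactification -/

section Compactification

open BoundedContinuousFunction

variable {S : Type*} {P : S → PMF S} {o : S}

instance : CompactSpace (MartinCompactification P o) :=
  isCompact_iff_compactSpace.1 (isClosed_closure (s := Set.range (martinMap P o))).isCompact

instance : T2Space (MartinCompactification P o) :=
  inferInstanceAs (T2Space (closure (Set.range (martinMap P o))))

instance [Countable S] : SecondCountableTopology (MartinCompactification P o) :=
  inferInstanceAs (SecondCountableTopology (closure (Set.range (martinMap P o))))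

instance [Countable S] : TopologicalSpace.MetrizableSpace (MartinCompactification P o) :=
  inferInstanceAs (TopologicalSpace.MetrizableSpace (closure (Set.range (martinMap P o))))

theorem lintegral_particleMeasure (b : S →₀ ℕ) {g : MartinCompactification P o → ℝ≥0∞}
    (hg : Measurable g) :
    ∫⁻ z, g z ∂(particleMeasure P o b : Measure (MartinCompactification P o))
      = weigh (fun x => g (toMartin P o x)) b := by
  rw [weigh_eq_sum, particleMeasure, FiniteMeasure.toMeasure_sum, lintegral_finsetSum_measure]
  refine Finset.sum_congr rfl fun x _ => ?_
  rw [FiniteMeasure.toMeasure_smul]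
  change ∫⁻ z, g z ∂((b x : ℝ≥0) • Measure.dirac (toMartin P o x)) = _
  rw [lintegral_smul_measure, lintegral_dirac' _ hg, ENNReal.smul_def]
  simp

/-- The normalized particle measure at time `n`. -/
def normalizedMeasure (P : S → PMF S) (o : S) (μ : PMF ℕ) (n : ℕ) (b : S →₀ ℕ) :
    FiniteMeasure (MartinCompactification P o) :=
  ((offspringMean μ).toNNReal⁻¹ ^ n) • particleMeasure P o b

theorem lintegral_normalizedMeasure {μ : PMF ℕ} (h0 : offspringMean μ ≠ 0)
    (hfin : offspringMean μ ≠ ∞) (n : ℕ) (b : S →₀ ℕ) {g : MartinCompactification P o → ℝ≥0∞}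
    (hg : Measurable g) :
    ∫⁻ z, g z ∂(normalizedMeasure P o μ n b : Measure (MartinCompactification P o))
      = (offspringMean μ)⁻¹ ^ n * weigh (fun x => g (toMartin P o x)) b := by
  have hc : (offspringMean μ).toNNReal ≠ 0 := by
    simp [ENNReal.toNNReal_eq_zero_iff, h0, hfin]
  rw [normalizedMeasure, FiniteMeasure.toMeasure_smul, lintegral_smul_measure,
    lintegral_particleMeasure b hg, ENNReal.smul_def, smul_eq_mul, ENNReal.coe_pow,
    ENNReal.coe_inv hc, ENNReal.coe_toNNReal hfin]

variable [Countable S]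

section LowerBound

variable [MeasurableSpace (S →₀ ℕ)] [DiscreteMeasurableSpace (S →₀ ℕ)]
variable {Ω : Type*} [MeasurableSpace Ω] {ℙ : Measure Ω} [IsProbabilityMeasure ℙ]
  {B : ℕ → Ω → (S →₀ ℕ)} {μ : PMF ℕ}

theorem one_le_lintegral_limit_univ (hsuper : 1 < offspringMean μ) (hfin : offspringMean μ ≠ ∞)
    (hL : LLogL μ) (hB : IsBRW ℙ P μ o B) {W : Ω → FiniteMeasure (MartinCompactification P o)}
    (hWt : ∀ᵐ ω ∂ℙ, Tendsto (fun n => normalizedMeasure P o μ n (B n ω)) atTop (𝓝 (W ω))) :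
    1 ≤ ∫⁻ ω, (W ω : Measure (MartinCompactification P o)) Set.univ ∂ℙ := by
  obtain ⟨hBm, hQB⟩ := IsMarkovChain.isPathLaw_map hB
  have : IsProbabilityMeasure (ℙ.map fun ω n => B n ω) :=
    Measure.isProbabilityMeasure_map hBm.aemeasurable
  have h0 : offspringMean μ ≠ 0 := (zero_lt_one.trans hsuper).ne'
  let V : (ℕ → S →₀ ℕ) → ℝ≥0∞ := fun b =>
    limsup (fun n => (offspringMean μ)⁻¹ ^ n * (size (b n) : ℝ≥0∞)) atTop
  have hVm : Measurable V := Measurable.limsup fun n =>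
    measurable_comp_apply (fun b : S →₀ ℕ => (offspringMean μ)⁻¹ ^ n * (size b : ℝ≥0∞)) n
  have hconv : ∀ᵐ b ∂(ℙ.map fun ω n => B n ω), V b ≠ ∞ ∧
      Tendsto (fun n => (offspringMean μ)⁻¹ ^ n * (size (b n) : ℝ≥0∞)) atTop (𝓝 (V b)) := by
    have h1 := ae_tendsto_weigh_of_superharmonic hQB h0 hfin (u := fun _ => 1) (by simp)
      fun x => (mean_const (P x) 1).le
    filter_upwards [h1] with b ⟨L, hL, hb⟩
    simp only [weigh_one] at hb
    have hV : V b = L := hb.limsup_eq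
    rw [hV]
    exact ⟨hL, hb⟩
  have h2 := one_le_lintegral_of_tendsto_size hQB hsuper hfin hL hconv
  rw [lintegral_map hVm hBm] at h2
  refine h2.trans_eq (lintegral_congr_ae ?_)
  filter_upwards [ae_of_ae_map hBm.aemeasurable hconv, hWt] with ω ⟨_, h3⟩ h4
  have h5 := FiniteMeasure.tendsto_iff_forall_lintegral_tendsto.1 h4 1
  refine tendsto_nhds_unique h3 ?_
  have h6 : ∫⁻ z, ((1 : MartinCompactification P o →ᵇ ℝ≥0) z : ℝ≥0∞)
      ∂(W ω : Measure (MartinCompactification P o)) =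
        (W ω : Measure (MartinCompactification P o)) Set.univ := by
    simp
  rw [← h6]
  refine h5.congr fun n => ?_
  rw [lintegral_normalizedMeasure h0 hfin n _ (1 : MartinCompactification P o →ᵇ
    ℝ≥0).measurable_coe_ennreal_comp, ← weigh_one]
  simp

end LowerBound

variable [MeasurableSpace S] [DiscreteMeasurableSpace S]
variable {Ω' : Type*} [MeasurableSpace Ω'] {ℙ' : Measure Ω'} [IsProbabilityMeasure ℙ']
  {X : ℕ → Ω' → S}

theorem exists_measurable_limit_toMartin (hirr : Irreducible P) (htrans : Transient P)
    (hX : IsMarkovChain ℙ' P o X) :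
    ∃ Xlim : Ω' → MartinCompactification P o, Measurable Xlim ∧
      ∀ᵐ ω ∂ℙ', Xlim ω ∈ martinBoundary P o ∧
        Tendsto (fun n => toMartin P o (X n ω)) atTop (𝓝 (Xlim ω)) := by
  obtain ⟨hXm, hQ⟩ := hX.isPathLaw_map
  have : IsProbabilityMeasure (ℙ'.map fun ω n => X n ω) :=
    Measure.isProbabilityMeasure_map hXm.aemeasurable
  obtain ⟨R, hRp, hR⟩ := hQ.exists_family hirr
  have hQR := hQ.unique (hR o)
  have hex := ae_exists_tendsto_toMartin hR hirr htrans o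
  rw [← hQR] at hex
  have hex' := ae_of_ae_map hXm.aemeasurable hex
  obtain ⟨Xlim, hm, hlim⟩ := measurable_limit_of_tendsto_metrizable_ae (μ := ℙ') (L := atTop)
    (f := fun n ω => toMartin P o (X n ω))
    (fun n => ((Measurable.of_discrete (f := toMartin P o)).comp
      ((measurable_pi_apply n).comp hXm)).aemeasurable)
    (hex'.mono fun ω ⟨z, _, hz⟩ => ⟨z, hz⟩)
  refine ⟨Xlim, hm, ?_⟩
  filter_upwards [hex', hlim] with ω ⟨z, hz1, hz2⟩ hω
  exact ⟨tendsto_nhds_unique hz2 hω ▸ hz1, hω⟩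

variable [MeasurableSpace (S →₀ ℕ)] [DiscreteMeasurableSpace (S →₀ ℕ)]
variable {Ω : Type*} [MeasurableSpace Ω] {ℙ : Measure Ω} [IsProbabilityMeasure ℙ]
  {B : ℕ → Ω → (S →₀ ℕ)} {μ : PMF ℕ}

theorem exists_measurable_limit_normalizedMeasure (hirr : Irreducible P) (htrans : Transient P)
    (hX : IsMarkovChain ℙ' P o X) (h0 : offspringMean μ ≠ 0) (hfin : offspringMean μ ≠ ∞)
    (hB : IsBRW ℙ P μ o B) :
    ∃ W : Ω → FiniteMeasure (MartinCompactification P o),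
      Measurable (fun ω => (W ω : Measure (MartinCompactification P o))) ∧
      ∀ᵐ ω ∂ℙ, Tendsto (fun n => normalizedMeasure P o μ n (B n ω)) atTop (𝓝 (W ω)) := by
  obtain ⟨hXm, hQ⟩ := hX.isPathLaw_map
  have : IsProbabilityMeasure (ℙ'.map fun ω n => X n ω) :=
    Measure.isProbabilityMeasure_map hXm.aemeasurable
  obtain ⟨R, hRp, hR⟩ := hQ.exists_family hirr
  obtain ⟨hBm, hQB⟩ := IsMarkovChain.isPathLaw_map hB
  have : IsProbabilityMeasure (ℙ.map fun ω n => B n ω) :=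
    Measure.isProbabilityMeasure_map hBm.aemeasurable
  refine exists_measurable_weak_limit (fun n f => ?_) fun f => ?_
  · exact (Measurable.of_discrete
      (f := fun b => (normalizedMeasure P o μ n b).testAgainstNN f)).comp
      ((measurable_pi_apply n).comp hBm)
  · have h1 : ∀ᵐ w ∂(R o), ∃ c,
        Tendsto (fun n => (f (toMartin P o (w n)) : ℝ≥0∞)) atTop (𝓝 c) := by
      filter_upwards [ae_exists_tendsto_toMartin hR hirr htrans o] with w ⟨z, _, hz⟩
      exact ⟨f z, ENNReal.tendsto_coe.2 ((f.continuous.tendsto z).comp hz)⟩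
    -- The summand `1` keeps the bound nonzero when `f = 0`.
    have h2 := ae_tendsto_weigh hQB h0 hfin hR (C := ((nndist f 0 + 1 : ℝ≥0) : ℝ≥0∞)) (by simp)
      ENNReal.coe_ne_top (fun y => ENNReal.coe_le_coe.2
        ((BoundedContinuousFunction.NNReal.upper_bound f _).trans le_self_add)) h1
    filter_upwards [ae_of_ae_map hBm.aemeasurable h2] with ω ⟨L, hL, hω⟩
    refine ⟨L.toNNReal, ?_⟩
    rw [← ENNReal.tendsto_coe, ENNReal.coe_toNNReal hL]
    refine hω.congr fun n => ?_
    rw [FiniteMeasure.testAgainstNN_coe_eq,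
      lintegral_normalizedMeasure h0 hfin n _ f.measurable_coe_ennreal_comp]

/-- The mean of the limit measure is dominated by the harmonic measure. -/
theorem bind_limit_le (hX : IsMarkovChain ℙ' P o X) (h0 : offspringMean μ ≠ 0)
    (hfin : offspringMean μ ≠ ∞) (hB : IsBRW ℙ P μ o B)
    {Xlim : Ω' → MartinCompactification P o} (hXlim : Measurable Xlim)
    (hXt : ∀ᵐ ω ∂ℙ', Tendsto (fun n => toMartin P o (X n ω)) atTop (𝓝 (Xlim ω)))
    {W : Ω → FiniteMeasure (MartinCompactification P o)}
    (hW : Measurable (fun ω => (W ω : Measure (MartinCompactification P o))))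
    (hWt : ∀ᵐ ω ∂ℙ, Tendsto (fun n => normalizedMeasure P o μ n (B n ω)) atTop (𝓝 (W ω)))
    {A : Set (MartinCompactification P o)} (hA : MeasurableSet A) :
    ∫⁻ ω, (W ω : Measure (MartinCompactification P o)) A ∂ℙ ≤ ℙ'.map Xlim A := by
  obtain ⟨hXm, hQ⟩ := hX.isPathLaw_map
  have : IsProbabilityMeasure (ℙ'.map fun ω n => X n ω) :=
    Measure.isProbabilityMeasure_map hXm.aemeasurable
  obtain ⟨hBm, hQB⟩ := IsMarkovChain.isPathLaw_map hB
  have : IsProbabilityMeasure (ℙ.map fun ω n => B n ω) :=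
    Measure.isProbabilityMeasure_map hBm.aemeasurable
  have : IsProbabilityMeasure (ℙ'.map Xlim) :=
    Measure.isProbabilityMeasure_map hXlim.aemeasurable
  have hXn : ∀ n, Measurable fun ω => toMartin P o (X n ω) := fun n =>
    (Measurable.of_discrete (f := toMartin P o)).comp ((measurable_pi_apply n).comp hXm)
  let ρ : Measure (MartinCompactification P o) :=
    ℙ.bind fun ω => (W ω : Measure (MartinCompactification P o))
  have hle : ∀ f : MartinCompactification P o →ᵇ ℝ≥0,
      ∫⁻ z, f z ∂ρ ≤ ∫⁻ z, f z ∂(ℙ'.map Xlim) := by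
    intro f
    have hf := f.measurable_coe_ennreal_comp
    let g : S → ℝ≥0∞ := fun x => f (toMartin P o x)
    have hEn : ∀ n, ∫⁻ ω, ∫⁻ z, f z ∂(normalizedMeasure P o μ n (B n ω) : Measure _) ∂ℙ
        = ∫⁻ ω, f (toMartin P o (X n ω)) ∂ℙ' := by
      intro n
      simp only [lintegral_normalizedMeasure h0 hfin n _ hf]
      have h1 := lintegral_normalized_weigh hQB h0 hfin n g
      rw [lintegral_map ((measurable_comp_apply (weigh g) n).const_mul _) hBm] at h1
      have h2 := hQ.lintegral_apply n g
      rw [lintegral_map (measurable_comp_apply g n) hXm] at h2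
      exact h1.trans h2.symm
    have hlimX : Tendsto (fun n => ∫⁻ ω, (f (toMartin P o (X n ω)) : ℝ≥0∞) ∂ℙ') atTop
        (𝓝 (∫⁻ ω, f (Xlim ω) ∂ℙ')) := by
      refine tendsto_lintegral_of_dominated_convergence (fun _ => ((nndist f 0 : ℝ≥0) : ℝ≥0∞))
        (fun n => hf.comp (hXn n)) (fun n => ae_of_all _ fun ω =>
          ENNReal.coe_le_coe.2 (BoundedContinuousFunction.NNReal.upper_bound f _)) (by simp) ?_
      filter_upwards [hXt] with ω hω
      exact ENNReal.tendsto_coe.2 ((f.continuous.tendsto _).comp hω)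
    rw [Measure.lintegral_bind hW.aemeasurable hf.aemeasurable, lintegral_map hf hXlim]
    calc ∫⁻ ω, ∫⁻ z, f z ∂(W ω : Measure _) ∂ℙ
        = ∫⁻ ω, liminf (fun n =>
            ∫⁻ z, f z ∂(normalizedMeasure P o μ n (B n ω) : Measure _)) atTop ∂ℙ := by
          refine lintegral_congr_ae ?_
          filter_upwards [hWt] with ω hω
          exact (FiniteMeasure.tendsto_iff_forall_lintegral_tendsto.1 hω f).liminf_eq.symm
      -- Fatou gives only an inequality: without `L log L`, mass may be lost in the limit.
      _ ≤ liminf (fun n => ∫⁻ ω,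
            ∫⁻ z, f z ∂(normalizedMeasure P o μ n (B n ω) : Measure _) ∂ℙ) atTop :=
          lintegral_liminf_le fun n => (Measurable.of_discrete (f := fun b =>
            ∫⁻ z, f z ∂(normalizedMeasure P o μ n b : Measure (MartinCompactification P o)))).comp
              ((measurable_pi_apply n).comp hBm)
      _ = ∫⁻ ω, f (Xlim ω) ∂ℙ' := by
          simp only [hEn]
          exact hlimX.liminf_eq
  have hρ : IsFiniteMeasure ρ := by
    refine ⟨lt_of_le_of_lt (b := 1) ?_ ENNReal.one_lt_top⟩
    have := hle 1
    simpa using this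
  rw [← Measure.bind_apply hA hW.aemeasurable]
  exact measure_le_of_forall_lintegral_le hle hA

end Compactification

end BRW

end

theorem theorem1 {S : Type*} [Countable S] (P : S → PMF S) (o : S)
    (hirr : BRW.Irreducible P) (htrans : BRW.Transient P)
    (μ : PMF ℕ) (hsuper : 1 < BRW.offspringMean μ) (hfin : BRW.offspringMean μ < ∞)
    -- the Markov chain `X` with law `𝐏ₒ`
    {Ω' : Type*} [MeasurableSpace Ω'] (ℙ' : Measure Ω') [IsProbabilityMeasure ℙ']
    (X : ℕ → Ω' → S) (hX : BRW.IsMarkovChain ℙ' P o X)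
    -- the branching random walk `B` with law `ℙₒ`
    {Ω : Type*} [MeasurableSpace Ω] (ℙ : Measure Ω) [IsProbabilityMeasure ℙ]
    (B : ℕ → Ω → (S →₀ ℕ)) (hB : BRW.IsBRW ℙ P μ o B) :
    ∃ Xlim : Ω' → BRW.MartinCompactification P o,
      Measurable Xlim ∧
      (∀ᵐ ω ∂ℙ', Xlim ω ∈ BRW.martinBoundary P o ∧
        Tendsto (fun n => BRW.toMartin P o (X n ω)) atTop (𝓝 (Xlim ω))) ∧
      ∃ W : Ω → FiniteMeasure (BRW.MartinCompactification P o),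
        Measurable (fun ω => (W ω : Measure (BRW.MartinCompactification P o))) ∧
        (∀ᵐ ω ∂ℙ, Tendsto
          (fun n => ((BRW.offspringMean μ).toNNReal⁻¹ ^ n) • BRW.particleMeasure P o (B n ω))
          atTop (𝓝 (W ω))) ∧
        (∀ᵐ ω ∂ℙ, (W ω : Measure (BRW.MartinCompactification P o))
          (BRW.harmonicBoundary ℙ' Xlim)ᶜ = 0) ∧
        (BRW.LLogL μ → ∀ A : Set (BRW.MartinCompactification P o), MeasurableSet A →
          ∫⁻ ω, (W ω : Measure (BRW.MartinCompactification P o)) A ∂ℙ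
            = ℙ' {ω | Xlim ω ∈ A}) := by
  let _ : MeasurableSpace S := ⊤
  let _ : MeasurableSpace (S →₀ ℕ) := ⊤
  have : DiscreteMeasurableSpace S := ⟨fun _ => trivial⟩
  have : DiscreteMeasurableSpace (S →₀ ℕ) := ⟨fun _ => trivial⟩
  have h0 : BRW.offspringMean μ ≠ 0 := (zero_lt_one.trans hsuper).ne'
  obtain ⟨Xlim, hXm, hX1⟩ := BRW.exists_measurable_limit_toMartin hirr htrans hX
  obtain ⟨W, hWm, hWt⟩ :=
    BRW.exists_measurable_limit_normalizedMeasure hirr htrans hX h0 hfin.ne hB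
  have hle : ∀ A : Set (BRW.MartinCompactification P o), MeasurableSet A →
      ∫⁻ ω, (W ω : Measure (BRW.MartinCompactification P o)) A ∂ℙ ≤ ℙ'.map Xlim A :=
    fun A hA => BRW.bind_limit_le hX h0 hfin.ne hB hXm (hX1.mono fun ω h => h.2) hWm hWt hA
  refine ⟨Xlim, hXm, hX1, W, hWm, hWt, ?_, fun hL A hA => ?_⟩
  · have hopen : MeasurableSet (BRW.harmonicBoundary ℙ' Xlim)ᶜ :=
      Measure.isOpen_compl_support.measurableSet
    have h1 := hle _ hopen
    have h2 : ℙ'.map Xlim (BRW.harmonicBoundary ℙ' Xlim)ᶜ = 0 := Measure.measure_compl_support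
    rw [h2, nonpos_iff_eq_zero,
      lintegral_eq_zero_iff (Measure.measurable_measure.1 hWm _ hopen)] at h1
    exact h1
  · have hprob : IsProbabilityMeasure (ℙ'.map Xlim) :=
      Measure.isProbabilityMeasure_map hXm.aemeasurable
    have hone := BRW.one_le_lintegral_limit_univ hsuper hfin.ne hL hB hWt
    have hmap : ℙ' {ω | Xlim ω ∈ A} = ℙ'.map Xlim A := (Measure.map_apply hXm hA).symm
    rw [hmap]
    refine le_antisymm (hle A hA) ?_
    have hsplit : ∫⁻ ω, (W ω : Measure (BRW.MartinCompactification P o)) Set.univ ∂ℙ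
        = ∫⁻ ω, (W ω : Measure (BRW.MartinCompactification P o)) A ∂ℙ
          + ∫⁻ ω, (W ω : Measure (BRW.MartinCompactification P o)) Aᶜ ∂ℙ := by
      rw [← lintegral_add_left (Measure.measurable_measure.1 hWm A hA)]
      simp only [measure_add_measure_compl hA]
    -- The mean of `W` is dominated on both `A` and `Aᶜ`, while its total mass is at least that of
    -- the probability measure dominating it. This forces equality on `A`.
    have h2 : ℙ'.map Xlim A + ℙ'.map Xlim Aᶜ
        ≤ ∫⁻ ω, (W ω : Measure (BRW.MartinCompactification P o)) A ∂ℙ + ℙ'.map Xlim Aᶜ := by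
      rw [measure_add_measure_compl hA, measure_univ]
      calc (1 : ℝ≥0∞) ≤ _ := hone
        _ = _ := hsplit
        _ ≤ _ := add_le_add_right (hle _ hA.compl) _
    exact (ENNReal.add_le_add_iff_right (measure_ne_top _ _)).1 h2
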